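/- For every $N\in\mathbb N$ let $(X_t)_{t\in\mathbb N}$ be an irreducible discrete-time Markov chain on a finite set $\Gamma_N$ with transition probabilities $p_N(x,y)$, reversible with respect to a probability measure $\mathbb Q_N$. For $I\subset\Gamma_N$ let $\tau^x_I=\inf\{t>0: X_t\in I\}$ for the chain started in $x$ ($\tau^x_y:=\tau^x_{\{y\}}$, $\inf\emptyset=\infty$). Let $\mathcal M_N\subset\Gamma_N$ be a set of metastable points: there are $a_N,b_N>0$ and a sequence $\varepsilon_N\to0$ with $a_N^{-1}\le\varepsilon_N b_N$ such that $$\mathbb P[\tau^z_{\mathcal M_N}\le\tau^z_z]\ge b_N\quad(z\in\Gamma_N),\qquad \mathbb P[\tau^x_y<\tau^x_x]\le a_N^{-1}\quad(x\ne y\in\mathcal M_N).$$ For $x\in\mathcal M_N$ put $$A(x)=\Big\{z\in\Gamma_N:\ \mathbb P[\tau^z_x=\tau^z_{\mathcal M_N}]=\max_{y\in\mathcal M_N}\mathbb P[\tau^z_y=\tau^z_{\mathcal M_N}]\Big\},\qquad R_x=\frac{\mathbb Q_N(x)}{\mathbb Q_N(A(x))},$$ $r_N=\max_{x\in\mathcal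 M_N}R_x$ and $c_N^{-1}=\min_{x\in\mathcal M_N}R_x$. For nonempty $I\subset\mathcal M_N$ and $x\in\mathcal M_N\setminus I$ put $T_{x,I}=\mathbb P[\tau^x_I\le\tau^x_x]^{-1}$ and, if $I\neq\mathcal M_N$, $T_I=\max_{x\in\mathcal M_N\setminus I}T_{x,I}$. Assume that the chains are generic: there is a sequence $\epsilon_N\to0$ such that (i) for all $x\ne y$ in $\mathcal M_N$ and all nonempty $I\subset\mathcal M_N\setminus\{x,y\}$, either $T_{x,I}\le\epsilon_N T_{y,I}$ or $T_{y,I}\le\epsilon_N T_{x,I}$; (ii) there is $m\in\mathcal M_N$ with $\mathbb Q_N(x)\le\epsilon_N\mathbb Q_N(m)$ for all $x\in\mathcal M_N\setminus\{m\}$. Assume also $r_N\,\varepsilon_N\,|\Gamma_N|\,|\mathcal M_N|\to0$. Then there are an absolute constant $C>0$ and, for each such family, an $N_0$ such that for all $N\ge N_0$, all $I\subset\mathcal M_N$ with $I\ne\emptyset$ and $\mathcal M_N\setminus I\neq\emptyset$, and $m_1\in\mathcal M_N\setminus I$ with $T_{m_1,I}=T_I$, the following holds. Let $T_1=T_I$,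 let $T_2=T_{I\cup\{m_1\}}$ if $I\cup\{m_1\}\ne\mathcal M_N$ and $T_2=|\Gamma_N|/b_N$ if $I\cup\{m_1\}=\mathcal M_N$. Then $\mathbb E[\tau^{m_1}_I]<\infty$, and for every $t\in\mathbb E[\tau^{m_1}_I]^{-1}\mathbb N$ (with $0\in\mathbb N$) there are real numbers $A,B$ with $$|A-1|\le C\,R_{m_1}c_N\frac{T_2}{T_1},\qquad |B-1|\le C\,R_{m_1}c_N\frac{T_2}{T_1},\qquad \mathbb P\big[\tau^{m_1}_I>t\,\mathbb E[\tau^{m_1}_I]\big]=A\,e^{-tB}.$$ -/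

import Mathlib

open MeasureTheory ProbabilityTheory Filter Topology
open scoped ENNReal

universe u

/-- An irreducible Markov chain on a finite state space (transition probabilities `p x y`),
reversible with respect to the probability vector `Q`. -/
structure RevChain (Γ : Type u) [Fintype Γ] where
  p : Γ → Γ → ℝ
  p_nonneg : ∀ x y, 0 ≤ p x y
  p_sum : ∀ x, ∑ y, p x y = 1
  Q : Γ → ℝ
  Q_nonneg : ∀ x, 0 ≤ Q x
  Q_sum : ∑ x, Q x = 1
  reversible : ∀ x y, Q x * p x y = Q y * p y x
  irreducible : ∀ x y, Relation.ReflTransGen (fun v w => 0 < p v w) x y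

/-- The hitting time `τ_I = inf {t > 0 : ω t ∈ I}` of a trajectory, equal to `⊤` if `I` is not
visited at any positive time. -/
noncomputable def hit {Γ : Type u} (I : Set Γ) (ω : ℕ → Γ) : ℕ∞ :=
  ⨅ (t : ℕ) (_ : 0 < t ∧ ω t ∈ I), (t : ℕ∞)

namespace RevChain

section Law

variable {Γ : Type u} [Fintype Γ] (X : RevChain Γ)

/-- The distribution `p x ·` of one step from `x`. -/
noncomputable def row (x : Γ) : PMF Γ :=
  PMF.ofFintype (fun y => ENNReal.ofReal (X.p x y)) (by
    rw [← ENNReal.ofReal_sum_of_nonneg (fun y _ => X.p_nonneg x y), X.p_sum x,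
      ENNReal.ofReal_one])

variable [MeasurableSpace Γ] [DiscreteMeasurableSpace Γ]

/-- The one-step transition kernel. -/
noncomputable def step : Kernel Γ Γ :=
  Kernel.ofFunOfCountable fun x => (X.row x).toMeasure

instance : IsMarkovKernel X.step :=
  ⟨fun x => inferInstanceAs (IsProbabilityMeasure (X.row x).toMeasure)⟩

/-- The law on trajectories `ℕ → Γ` of the chain started in `x` at time `0`. -/
noncomputable def law (x : Γ) : Measure (ℕ → Γ) :=
  Kernel.traj (X := fun _ => Γ)
    (fun n => X.step.comap (fun h => h ⟨n, Finset.mem_Iic.2 le_rfl⟩) (measurable_pi_apply _))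
    0 (fun _ => x)

/-- The expected hitting time `E[τ^x_I]`, in `[0, ∞]`. -/
noncomputable def meanHit (x : Γ) (I : Set Γ) : ℝ≥0∞ :=
  ∫⁻ ω, (hit I ω : ℝ≥0∞) ∂(X.law x)

/-- The local valley `A(x)` of `x ∈ M`: the points from which the first visited point of `M` is
most likely to be `x`. -/
def valley (M : Finset Γ) (x : Γ) : Set Γ :=
  {z | IsGreatest
    ((fun y => (X.law z).real {ω | hit {y} ω = hit (M : Set Γ) ω}) '' (M : Set Γ))
    ((X.law z).real {ω | hit {x} ω = hit (M : Set Γ) ω})}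

/-- `Q(A)` for a set `A` of states. -/
noncomputable def mass (A : Set Γ) : ℝ := ∑ x, A.indicator X.Q x

/-- `R_x = Q(x) / Q(A(x))`. -/
noncomputable def R (M : Finset Γ) (x : Γ) : ℝ := X.Q x / X.mass (X.valley M x)

/-- `r = max_{x ∈ M} R_x`. -/
noncomputable def rMax (M : Finset Γ) : ℝ := sSup (X.R M '' (M : Set Γ))

/-- `c`, defined by `c⁻¹ = min_{x ∈ M} R_x`. -/
noncomputable def c (M : Finset Γ) : ℝ := (sInf (X.R M '' (M : Set Γ)))⁻¹

/-- `T_{x,I} = P[τ^x_I ≤ τ^x_x]⁻¹`. -/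
noncomputable def T (x : Γ) (I : Set Γ) : ℝ :=
  ((X.law x).real {ω | hit I ω ≤ hit {x} ω})⁻¹

/-- `T_I = max_{x ∈ M \ I} T_{x,I}`. -/
noncomputable def Tsup (M : Finset Γ) (I : Set Γ) : ℝ :=
  sSup ((fun x => X.T x I) '' ((M : Set Γ) \ I))

open Classical in
/-- The second depth `T_2` for the exclusion set `I` and the first point `m₁`: it is
`T_{I ∪ {m₁}}` if `M` has a point outside `I ∪ {m₁}`, and `|Γ| / b` otherwise. -/
noncomputable def secondDepth (M : Finset Γ) (b : ℝ) (I : Finset Γ) (m₁ : Γ) : ℝ :=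
  if ((M : Set Γ) \ insert m₁ (I : Set Γ)).Nonempty
  then X.Tsup M (insert m₁ (I : Set Γ))
  else (Fintype.card Γ : ℝ) / b

/-- `M` is a set of metastable points with constants `a`, `b`. -/
structure IsMetastable (M : Finset Γ) (a b : ℝ) : Prop where
  a_pos : 0 < a
  b_pos : 0 < b
  reach : ∀ z, b ≤ (X.law z).real {ω | hit (M : Set Γ) ω ≤ hit {z} ω}
  separated : ∀ x ∈ M, ∀ y ∈ M, x ≠ y →
    (X.law x).real {ω | hit {y} ω < hit {x} ω} ≤ a⁻¹

/-- The chain is generic on the level of `M`, with parameter `ϵ`. -/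
structure IsGeneric (M : Finset Γ) (ϵ : ℝ) : Prop where
  gap : ∀ x ∈ M, ∀ y ∈ M, x ≠ y → ∀ I ⊆ M, I.Nonempty → x ∉ I → y ∉ I →
    X.T x (I : Set Γ) ≤ ϵ * X.T y (I : Set Γ) ∨ X.T y (I : Set Γ) ≤ ϵ * X.T x (I : Set Γ)
  top : ∃ m ∈ M, ∀ x ∈ M, x ≠ m → X.Q x ≤ ϵ * X.Q m

end Law

end RevChain

/-! Fix a starting point `x` and a target `I`. Let `e` be the equilibrium potential, which is one at
`x`, zero on `I` and harmonic elsewhere. Write `K` for the transition operator killed on `I` and `D`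
for the trace of the Green function of the chain killed on `I ∪ {x}`. The proof is deterministic
potential theory: if `D` is small compared with the mean hitting time, then `e` is almost an
eigenfunction of `K`, and the hitting time is almost exponential.

The engine is `green_le`: the Green operator killed on `I ∪ {x}` maps a nonnegative superharmonic
function to at most `D` times itself, pointwise. The correction `quasiEigen` of `e` by a multiple of
its Green potential satisfies an eigenvalue equation with `e` on the right-hand side, and lies
between `e` and `(1 + λD) e`. This gives two geometric rates that agree up to the factor `1 + λD`.
The lower bound on survival is immediate (`surv_lower`). For the upper bound the remainder `1 - e`
must be controlled. It is not small at every point, but its contribution along the chain from `x`,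
summed over a time window, is small by reversibility (`sum_surv_window_le`), and monotonicity of the
survival probability makes the window bound pointwise. Elementary analysis of logarithms then
compares the rate with the inverse mean (`abs_log_surv_add_le`), with relative error of order `(D +
1)` over the mean.

Metastability enters in bounding the two sides of this quotient. Decomposing at the first visit to
`M` (`greenTrace_le`) bounds `D` by `|Γ| / b` plus the sum over the remaining metastable points of
their depth times the normalised mass attracted to them. By genericity the depths are dominated
geometrically by the largest, and the attracted mass is comparable to the mass of the valley
(`basin_le`, `le_basin`), so `D + 1` is at most a multiple of `c T₂`. The mean is mass over escape
probability (`esc_mul_mean`), hence at least `T₁ / (2 R)`. The comparison of masses rests on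
`conductance_le_two_mul`: a state has a small conductance to any metastable point other than its
most likely one. -/

/-! ### Trajectories: hitting times under a shift, and measures on path space. -/

section Paths

variable {Γ : Type u}

/-- The trajectory that starts in `x` and then follows `ω`. -/
def consPath (x : Γ) (ω : ℕ → Γ) : ℕ → Γ
  | 0 => x
  | n + 1 => ω n

theorem consPath_zero (x : Γ) (ω : ℕ → Γ) : consPath x ω 0 = x := rfl

theorem lt_hit_iff (I : Set Γ) (ω : ℕ → Γ) (n : ℕ) :
    (n : ℕ∞) < hit I ω ↔ ∀ t, 0 < t → t ≤ n → ω t ∉ I := by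
  constructor
  · intro h t ht htn hmem
    have h1 : hit I ω ≤ (t : ℕ∞) := iInf₂_le_of_le t ⟨ht, hmem⟩ le_rfl
    have h2 : (t : ℕ∞) ≤ n := by exact_mod_cast htn
    exact absurd (h.trans_le (h1.trans h2)) (lt_irrefl _)
  · intro h
    have h1 : ((n + 1 : ℕ) : ℕ∞) ≤ hit I ω := by
      refine le_iInf₂ fun t ht => ?_
      by_contra hlt
      have hlt' : t < n + 1 := by exact_mod_cast not_le.1 hlt
      exact h t ht.1 (by omega) ht.2
    exact lt_of_lt_of_le (by exact_mod_cast Nat.lt_succ_self n) h1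

theorem one_le_hit (I : Set Γ) (ω : ℕ → Γ) : 1 ≤ hit I ω := by
  have h := (lt_hit_iff I ω 0).2 fun t ht ht0 => by omega
  simpa using Order.add_one_le_of_lt h

theorem hit_consPath_of_mem {I : Set Γ} {ω : ℕ → Γ} (x : Γ) (h : ω 0 ∈ I) :
    hit I (consPath x ω) = 1 := by
  refine le_antisymm ?_ (one_le_hit _ _)
  exact iInf₂_le_of_le 1 ⟨one_pos, h⟩ le_rfl

/-- Since `hit` ignores time `0`, it does not see `ω 0`; prepending `x` moves that point to time
one. Excluding it makes the shift add exactly one. -/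
theorem hit_consPath_of_notMem {I : Set Γ} {ω : ℕ → Γ} (x : Γ) (h : ω 0 ∉ I) :
    hit I (consPath x ω) = hit I ω + 1 := by
  apply le_antisymm
  · rcases eq_or_ne (hit I ω) ⊤ with htop | htop
    · rw [htop]; exact le_top
    · obtain ⟨n, hn⟩ := ENat.ne_top_iff_exists.1 htop
      rw [← hn]
      by_contra hlt
      have h1 := (lt_hit_iff I (consPath x ω) (n + 1)).1 (by push_cast; exact not_le.1 hlt)
      have h2 : (n : ℕ∞) < hit I ω :=
        (lt_hit_iff I ω n).2 fun t ht htn => h1 (t + 1) (by omega) (by omega)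
      rw [← hn] at h2
      exact lt_irrefl _ h2
  · refine le_iInf₂ fun t ht => ?_
    obtain ⟨s, rfl⟩ : ∃ s, t = s + 1 := ⟨t - 1, by omega⟩
    have hs : 0 < s := by
      rcases Nat.eq_zero_or_pos s with rfl | hs
      · exact absurd ht.2 h
      · exact hs
    push_cast
    gcongr
    exact iInf₂_le_of_le s ⟨hs, ht.2⟩ le_rfl

variable [MeasurableSpace Γ]

theorem measurable_consPath (x : Γ) : Measurable (consPath x) := by
  refine measurable_pi_lambda _ fun n => ?_
  cases n with
  | zero => exact measurable_const
  | succ n => exact measurable_pi_apply n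

variable [DiscreteMeasurableSpace Γ]

theorem measurable_hit (I : Set Γ) : Measurable (hit I) := by
  have hlt : ∀ n : ℕ, MeasurableSet {ω : ℕ → Γ | (n : ℕ∞) < hit I ω} := by
    intro n
    have : {ω : ℕ → Γ | (n : ℕ∞) < hit I ω} =
        ⋂ t ∈ {t | 0 < t ∧ t ≤ n}, (fun ω : ℕ → Γ => ω t) ⁻¹' Iᶜ := by
      ext ω
      simp [lt_hit_iff]
    rw [this]
    exact MeasurableSet.biInter (Set.to_countable _) fun t _ =>
      measurable_pi_apply t MeasurableSet.of_discrete
  refine ENat.measurable_iff.2 fun n => ?_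
  have : hit I ⁻¹' {(n : ℕ∞)} = (⋂ m ∈ {m | m < n}, {ω : ℕ → Γ | (m : ℕ∞) < hit I ω}) \
      {ω : ℕ → Γ | (n : ℕ∞) < hit I ω} := by
    ext ω
    simp only [Set.mem_preimage, Set.mem_singleton_iff, Set.mem_sdiff, Set.mem_iInter,
      Set.mem_ofPred_eq, not_lt]
    constructor
    · intro h
      rw [h]
      exact ⟨fun m hm => by exact_mod_cast hm, le_rfl⟩
    · rintro ⟨h1, h2⟩
      refine le_antisymm h2 ?_
      cases n with
      | zero => simp
      | succ n => simpa using Order.add_one_le_of_lt (h1 n (Nat.lt_succ_self n))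
  rw [this]
  exact (MeasurableSet.biInter (Set.to_countable _) fun m _ => hlt m).diff (hlt n)

/-- Any comparison of two hitting times is an event. -/
theorem measurableSet_hit_rel (I J : Set Γ) (r : ℕ∞ → ℕ∞ → Prop) :
    MeasurableSet {ω : ℕ → Γ | r (hit I ω) (hit J ω)} :=
  ((measurable_hit I).prodMk (measurable_hit J))
    (MeasurableSet.of_discrete (s := {q : ℕ∞ × ℕ∞ | r q.1 q.2}))

/-- Finite measures on trajectories that agree on cylinders over points are equal. -/
theorem measure_paths_ext [Countable Γ] (μ ν : Measure (ℕ → Γ)) [IsFiniteMeasure μ]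
    [IsFiniteMeasure ν]
    (h : ∀ (n : ℕ) (a : ℕ → Γ), μ {ω | ∀ i ≤ n, ω i = a i} = ν {ω | ∀ i ≤ n, ω i = a i})
    (huniv : μ Set.univ = ν Set.univ) : μ = ν := by
  rcases isEmpty_or_nonempty Γ with hΓ | hΓ
  · ext s hs
    have hs : s = ∅ := Set.eq_empty_of_forall_notMem fun ω _ => hΓ.elim (ω 0)
    simp [hs]
  refine ext_of_generate_finite (measurableCylinders fun _ : ℕ => Γ)
    generateFrom_measurableCylinders.symm isPiSystem_measurableCylinders ?_ huniv
  intro t ht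
  obtain ⟨N, S, mS, rfl⟩ : ∃ N S, MeasurableSet S ∧ t = cylinder (Finset.Iic N) S := by
    simpa [measurableCylinders_nat] using ht
  have hmap : μ.map (Preorder.frestrictLe (π := fun _ => Γ) N) =
      ν.map (Preorder.frestrictLe (π := fun _ => Γ) N) := by
    refine Measure.ext_of_singleton fun a => ?_
    rw [Measure.map_apply (Preorder.measurable_frestrictLe N) (measurableSet_singleton a),
      Measure.map_apply (Preorder.measurable_frestrictLe N) (measurableSet_singleton a)]
    have hset : (Preorder.frestrictLe (π := fun _ => Γ) N) ⁻¹' {a} =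
        {ω : ℕ → Γ | ∀ i ≤ N, ω i =
          (fun j => if hj : j ≤ N then a ⟨j, Finset.mem_Iic.2 hj⟩ else Classical.arbitrary Γ) i} := by
      ext ω
      simp only [Set.mem_preimage, Set.mem_singleton_iff, Set.mem_ofPred_eq]
      constructor
      · rintro rfl i hi
        simp [hi]
      · intro hω
        ext ⟨i, hi⟩
        have := hω i (Finset.mem_Iic.1 hi)
        simpa [Finset.mem_Iic.1 hi] using this
    rw [hset, h]
  have := congrArg (fun m => m S) hmap
  rw [Measure.map_apply (Preorder.measurable_frestrictLe N) mS,
    Measure.map_apply (Preorder.measurable_frestrictLe N) mS] at this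
  exact this

end Paths

/-! ### The law of the chain and the Markov property. -/

namespace RevChain

variable {Γ : Type u} [Fintype Γ] (X : RevChain Γ) [MeasurableSpace Γ] [DiscreteMeasurableSpace Γ]

instance isProbabilityMeasure_law (x : Γ) : IsProbabilityMeasure (X.law x) := by
  unfold law; infer_instance

theorem step_singleton (x y : Γ) : X.step x {y} = ENNReal.ofReal (X.p x y) := by
  change (X.row x).toMeasure {y} = _
  rw [PMF.toMeasure_apply_singleton _ _ (measurableSet_singleton y)]
  rfl

-- Apart from its total mass, the Ionescu-Tulcea construction enters the proof only through these
-- cylinder probabilities.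
open Classical in
theorem law_cylinder (x : Γ) (n : ℕ) (a : ℕ → Γ) :
    X.law x {ω | ∀ i ≤ n, ω i = a i} =
      if a 0 = x then ∏ i ∈ Finset.range n, ENNReal.ofReal (X.p (a i) (a (i + 1))) else 0 := by
  set κ : (n : ℕ) → Kernel ((i : Finset.Iic n) → Γ) Γ :=
    fun n => X.step.comap (fun h => h ⟨n, Finset.mem_Iic.2 le_rfl⟩) (measurable_pi_apply _) with hκ
  have hset : ∀ n, {ω : ℕ → Γ | ∀ i ≤ n, ω i = a i} =
      (Preorder.frestrictLe (π := fun _ => Γ) n) ⁻¹' {fun i : Finset.Iic n => a i} := by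
    intro n
    ext ω
    simp only [Set.mem_preimage, Set.mem_singleton_iff, Set.mem_ofPred_eq]
    constructor
    · intro hω
      ext ⟨i, hi⟩
      exact hω i (Finset.mem_Iic.1 hi)
    · intro hω i hi
      exact congrFun hω ⟨i, Finset.mem_Iic.2 hi⟩
  induction n with
  | zero =>
    rw [hset, ← Measure.map_apply (Preorder.measurable_frestrictLe 0) (measurableSet_singleton _)]
    unfold law
    rw [Kernel.traj_map_frestrictLe_apply, Kernel.partialTraj_self, Kernel.id_apply,
      Measure.dirac_apply' _ (measurableSet_singleton _)]
    simp only [Set.indicator, Set.mem_singleton_iff, Pi.one_apply, Finset.range_zero,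
      Finset.prod_empty]
    congr 1
    apply propext
    constructor
    · intro h; exact (congrFun h ⟨0, Finset.mem_Iic.2 le_rfl⟩).symm
    · rintro rfl
      ext ⟨i, hi⟩
      have : i = 0 := by simpa using hi
      subst this; rfl
  | succ n ih =>
    have hpre : {ω : ℕ → Γ | ∀ i ≤ n + 1, ω i = a i} =
        (fun ω : ℕ → Γ => (Preorder.frestrictLe (π := fun _ => Γ) n ω, ω (n + 1))) ⁻¹'
          (({fun i : Finset.Iic n => a i} : Set (Finset.Iic n → Γ)) ×ˢ {a (n + 1)}) := by
      have hs := hset n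
      ext ω
      have hω : (∀ i ≤ n, ω i = a i) ↔ (Preorder.frestrictLe (π := fun _ => Γ) n) ω = fun i : Finset.Iic n => a i :=
        Set.ext_iff.1 hs ω
      simp only [Set.mem_preimage, Set.mem_prod, Set.mem_singleton_iff, Set.mem_ofPred_eq, ← hω]
      constructor
      · intro h; exact ⟨fun i hi => h i (by omega), h _ le_rfl⟩
      · rintro ⟨h1, h2⟩ i hi
        rcases Nat.lt_or_ge i (n + 1) with h | h
        · exact h1 i (by omega)
        · have : i = n + 1 := by omega
          subst this; exact h2
    have hmeas : MeasurableSet (({fun i : Finset.Iic n => a i} : Set (Finset.Iic n → Γ)) ×ˢ {a (n + 1)}) :=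
      (measurableSet_singleton _).prod (measurableSet_singleton _)
    have key := Kernel.partialTraj_compProd_eq_map_traj (X := fun _ => Γ) (κ := κ) (Nat.zero_le n)
      (x₀ := fun _ => x)
    rw [← Kernel.traj_map_frestrictLe_apply] at key
    change (X.law x).map _ ⊗ₘ _ = (X.law x).map _ at key
    rw [hpre, ← Measure.map_apply (by fun_prop) hmeas, ← key,
      Measure.compProd_apply_prod (measurableSet_singleton _) (measurableSet_singleton _),
      Measure.restrict_singleton, lintegral_smul_measure, lintegral_dirac, Measure.map_apply
      (Preorder.measurable_frestrictLe n) (measurableSet_singleton _), ← hset n, ih]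
    have h2 : (κ n) (fun i : Finset.Iic n => a i) {a (n + 1)} = ENNReal.ofReal (X.p (a n) (a (n + 1))) := by
      rw [hκ, Kernel.comap_apply, step_singleton]
    rw [h2, Finset.prod_range_succ]
    split_ifs <;> simp

theorem law_eq_sum (x : Γ) :
    X.law x = ∑ y, ENNReal.ofReal (X.p x y) • (X.law y).map (consPath x) := by
  classical
  have hsum : ∑ y, ENNReal.ofReal (X.p x y) = 1 := by
    rw [← ENNReal.ofReal_sum_of_nonneg (fun y _ => X.p_nonneg x y), X.p_sum x, ENNReal.ofReal_one]
  have hprob : ∀ y, IsProbabilityMeasure ((X.law y).map (consPath x)) := fun y =>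
    Measure.isProbabilityMeasure_map (measurable_consPath x).aemeasurable
  have huniv : (∑ y, ENNReal.ofReal (X.p x y) • (X.law y).map (consPath x)) Set.univ = 1 := by
    simp [Measure.finsetSum_apply, hsum]
  have hfin : IsFiniteMeasure (∑ y, ENNReal.ofReal (X.p x y) • (X.law y).map (consPath x)) :=
    ⟨by rw [huniv]; exact ENNReal.one_lt_top⟩
  refine measure_paths_ext _ _ (fun n a => ?_) (by rw [huniv, measure_univ])
  have hcyl : MeasurableSet {ω : ℕ → Γ | ∀ i ≤ n, ω i = a i} := by
    have : {ω : ℕ → Γ | ∀ i ≤ n, ω i = a i} =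
        ⋂ i ∈ Set.Iic n, (fun ω : ℕ → Γ => ω i) ⁻¹' {a i} := by
      ext; simp
    rw [this]
    exact MeasurableSet.biInter (Set.to_countable _) fun i _ =>
      measurable_pi_apply i (measurableSet_singleton (a i))
  rw [law_cylinder]
  simp only [Measure.finsetSum_apply, Measure.smul_apply, smul_eq_mul,
    Measure.map_apply (measurable_consPath x) hcyl]
  cases n with
  | zero =>
    have : ∀ y, X.law y (consPath x ⁻¹' {ω | ∀ i ≤ 0, ω i = a i}) = if a 0 = x then 1 else 0 := by
      intro y
      by_cases h : a 0 = x
      · have : consPath x ⁻¹' {ω | ∀ i ≤ 0, ω i = a i} = Set.univ := by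
          ext ω; simp [consPath_zero, h]
        rw [this, measure_univ, if_pos h]
      · have : consPath x ⁻¹' {ω | ∀ i ≤ 0, ω i = a i} = ∅ := by
          ext ω; simp [consPath_zero, Ne.symm h]
        rw [this, measure_empty, if_neg h]
    simp only [this, ← Finset.sum_mul, hsum]
    simp
  | succ n =>
    have : ∀ y, X.law y (consPath x ⁻¹' {ω | ∀ i ≤ n + 1, ω i = a i}) =
        if a 0 = x then X.law y {ω | ∀ i ≤ n, ω i = a (i + 1)} else 0 := by
      intro y
      by_cases h : a 0 = x
      · rw [if_pos h]
        congr 1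
        ext ω
        simp only [Set.mem_preimage, Set.mem_ofPred_eq]
        constructor
        · intro hω i hi
          exact hω (i + 1) (by omega)
        · intro hω i hi
          cases i with
          | zero => exact h.symm
          | succ i => exact hω i (by omega)
      · rw [if_neg h]
        have : consPath x ⁻¹' {ω | ∀ i ≤ n + 1, ω i = a i} = ∅ := by
          ext ω
          simp only [Set.mem_preimage, Set.mem_ofPred_eq, Set.mem_empty_iff_false, iff_false]
          intro hω
          exact h (hω 0 (by omega)).symm
        rw [this, measure_empty]
    simp only [this]
    by_cases h : a 0 = x
    · simp only [if_pos h, law_cylinder X _ n fun i => a (i + 1), zero_add]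
      rw [Finset.sum_eq_single (a 1)]
      · rw [if_pos rfl, Finset.prod_range_succ', mul_comm, h]
      · intro y _ hy
        rw [if_neg (Ne.symm hy), mul_zero]
      · simp
    · simp [h]

/-- The Markov property at time one. -/
theorem law_real_eq_sum (x : Γ) {V : Set (ℕ → Γ)} (hV : MeasurableSet V) :
    (X.law x).real V = ∑ y, X.p x y * (X.law y).real (consPath x ⁻¹' V) := by
  rw [measureReal_def, law_eq_sum]
  simp only [Measure.finsetSum_apply, Measure.smul_apply, smul_eq_mul,
    Measure.map_apply (measurable_consPath x) hV]
  rw [ENNReal.toReal_sum fun y _ => ENNReal.mul_ne_top ENNReal.ofReal_ne_top (measure_ne_top _ _)]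
  refine Finset.sum_congr rfl fun y _ => ?_
  rw [ENNReal.toReal_mul, ENNReal.toReal_ofReal (X.p_nonneg x y), measureReal_def]

theorem law_start (x : Γ) : ∀ᵐ ω ∂X.law x, ω 0 = x := by
  classical
  have h := X.law_cylinder x 0 fun _ => x
  have h1 : X.law x {ω : ℕ → Γ | ω 0 = x} = 1 := by simpa using h
  have hm : MeasurableSet ((fun ω : ℕ → Γ => ω 0) ⁻¹' {x}) :=
    measurable_pi_apply 0 (measurableSet_singleton x)
  exact (prob_compl_eq_zero_iff hm).2 h1

end RevChain

/-! ### Discrete potential theory: Dirichlet problem, escape probabilities, Green function. -/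

namespace RevChain

theorem singleton_subset_insert {Γ : Type u} (x : Γ) (J : Set Γ) : ({x} : Set Γ) ⊆ insert x J :=
  Set.singleton_subset_iff.2 (Set.mem_insert x J)

section Potential

variable {Γ : Type u} [Fintype Γ] (X : RevChain Γ)

/-- The transition operator. -/
def P : Module.End ℝ (Γ → ℝ) where
  toFun f z := ∑ y, X.p z y * f y
  map_add' f g := by ext z; simp [mul_add, Finset.sum_add_distrib]
  map_smul' c f := by ext z; simp [Finset.mul_sum, mul_left_comm]

/-- The generator `1 - P`. -/
def lap : Module.End ℝ (Γ → ℝ) := 1 - X.P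

theorem P_apply (f : Γ → ℝ) (z : Γ) : X.P f z = ∑ y, X.p z y * f y := rfl

theorem lap_apply (f : Γ → ℝ) (z : Γ) : X.lap f z = f z - X.P f z := rfl

theorem P_mono {f g : Γ → ℝ} (h : ∀ y, f y ≤ g y) (z : Γ) : X.P f z ≤ X.P g z :=
  Finset.sum_le_sum fun y _ => mul_le_mul_of_nonneg_left (h y) (X.p_nonneg z y)

theorem P_const (c : ℝ) (z : Γ) : X.P (fun _ => c) z = c := by
  rw [P_apply, ← Finset.sum_mul, X.p_sum, one_mul]

theorem lap_const (c : ℝ) (z : Γ) : X.lap (fun _ => c) z = 0 := by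
  rw [lap_apply, P_const, sub_self]

theorem P_nonneg {f : Γ → ℝ} (h : ∀ y, 0 ≤ f y) (z : Γ) : 0 ≤ X.P f z :=
  Finset.sum_nonneg fun y _ => mul_nonneg (X.p_nonneg z y) (h y)

/-- A positive maximum lies off `S`, and subharmonicity there forces every point reachable in one
step to share it. Irreducibility carries it into `S`, where positive values are excluded. -/
theorem max_principle {S : Set Γ} (hS : S.Nonempty) {f : Γ → ℝ}
    (hf : ∀ z ∉ S, X.lap f z ≤ 0) (hfS : ∀ z ∈ S, f z ≤ 0) (z : Γ) : f z ≤ 0 := by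
  obtain ⟨s, hs⟩ := hS
  have : Nonempty Γ := ⟨s⟩
  obtain ⟨w, hw⟩ := Finite.exists_max f
  by_contra! hz
  have hwpos : 0 < f w := hz.trans_le (hw z)
  have hmax : ∀ y, Relation.ReflTransGen (fun v w => 0 < X.p v w) w y → f y = f w := by
    intro y hy
    induction hy with
    | refl => rfl
    | @tail v y _ hvy ih =>
      have hv : v ∉ S := fun hv => absurd (hfS v hv) (by rw [ih]; exact not_le.2 hwpos)
      have h1 := hf v hv
      rw [lap_apply, ih] at h1
      have h2 : ∑ y, X.p v y * (f w - f y) ≤ 0 := by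
        simp only [mul_sub, Finset.sum_sub_distrib, ← Finset.sum_mul, X.p_sum, one_mul]
        exact h1
      have h3 : ∀ y ∈ Finset.univ, 0 ≤ X.p v y * (f w - f y) := fun y _ =>
        mul_nonneg (X.p_nonneg v y) (sub_nonneg.2 (hw y))
      have h4 := (Finset.sum_eq_zero_iff_of_nonneg h3).1
        (le_antisymm h2 (Finset.sum_nonneg h3)) y (Finset.mem_univ y)
      rcases mul_eq_zero.1 h4 with h | h
      · exact absurd h hvy.ne'
      · linarith
  have := hmax s (X.irreducible w s)
  linarith [hfS s hs]

/-- The comparison principle for the Dirichlet problem with boundary `S`. -/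
theorem comparison {S : Set Γ} (hS : S.Nonempty) {f g : Γ → ℝ}
    (hfg : ∀ z ∉ S, X.lap f z ≤ X.lap g z) (hfgS : ∀ z ∈ S, f z ≤ g z) (z : Γ) : f z ≤ g z := by
  have := X.max_principle hS (f := f - g)
    (fun z hz => by rw [map_sub, Pi.sub_apply]; linarith [hfg z hz])
    (fun z hz => by rw [Pi.sub_apply]; linarith [hfgS z hz]) z
  rw [Pi.sub_apply] at this
  linarith

open Classical in
-- The maximum principle makes the linear map injective, hence surjective in finite dimension. A
-- single `g` encodes the boundary values on `S` and the source off `S`.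
theorem exists_dirichlet {S : Set Γ} (hS : S.Nonempty) (g : Γ → ℝ) :
    ∃ u : Γ → ℝ, (∀ z ∈ S, u z = g z) ∧ ∀ z ∉ S, X.lap u z = g z := by
  let T : Module.End ℝ (Γ → ℝ) :=
    { toFun := fun u z => if z ∈ S then u z else X.lap u z
      map_add' := fun u v => by ext z; by_cases h : z ∈ S <;> simp [h]
      map_smul' := fun c u => by ext z; by_cases h : z ∈ S <;> simp [h] }
  have hT : ∀ u z, T u z = if z ∈ S then u z else X.lap u z := fun _ _ => rfl
  have hinj : Function.Injective T := by
    rw [injective_iff_map_eq_zero]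
    intro u hu
    have h1 : ∀ z ∈ S, u z = 0 := fun z hz => by
      have := congrFun hu z
      rwa [hT, if_pos hz] at this
    have h2 : ∀ z ∉ S, X.lap u z = 0 := fun z hz => by
      have := congrFun hu z
      rwa [hT, if_neg hz] at this
    ext z
    refine le_antisymm ?_ ?_
    · exact X.max_principle hS (fun z hz => (h2 z hz).le) (fun z hz => (h1 z hz).le) z
    · have := X.max_principle hS (f := -u) (fun z hz => by simp [h2 z hz])
        (fun z hz => by simp [h1 z hz]) z
      simpa using this
  obtain ⟨u, hu⟩ := LinearMap.injective_iff_surjective.1 hinj g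
  refine ⟨u, fun z hz => ?_, fun z hz => ?_⟩
  · have := congrFun hu z
    rwa [hT, if_pos hz] at this
  · have := congrFun hu z
    rwa [hT, if_neg hz] at this

open Classical in
/-- The function equal to `1` on `A`, to `0` on `S \ A`, and harmonic off `S`. -/
noncomputable def harm (A S : Set Γ) : Γ → ℝ :=
  if hS : S.Nonempty then (X.exists_dirichlet hS (A.indicator fun _ => 1)).choose else 0

/-- The escape probability from `x` to `J`, the value at `x` of the generator applied to the
equilibrium potential `X.harm {x} (insert x J)`: the probability to visit `J` before `x`. -/
noncomputable def esc (x : Γ) (J : Set Γ) : ℝ := X.lap (X.harm {x} (insert x J)) x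

variable {X}

section Harm

variable {A S : Set Γ}

theorem harm_spec (hS : S.Nonempty) (hAS : A ⊆ S) :
    (∀ z ∈ S, X.harm A S z = A.indicator (fun _ => 1) z) ∧
      ∀ z ∉ S, X.lap (X.harm A S) z = 0 := by
  rw [harm, dif_pos hS]
  have h := (X.exists_dirichlet hS (A.indicator fun _ => 1)).choose_spec
  refine ⟨h.1, fun z hz => ?_⟩
  rw [h.2 z hz, Set.indicator_of_notMem fun hzA => hz (hAS hzA)]

theorem harm_of_mem (hAS : A ⊆ S) {z : Γ} (hz : z ∈ A) : X.harm A S z = 1 := by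
  rw [(harm_spec ⟨z, hAS hz⟩ hAS).1 z (hAS hz), Set.indicator_of_mem hz]

theorem harm_of_notMem (hAS : A ⊆ S) {z : Γ} (hz : z ∈ S) (hzA : z ∉ A) : X.harm A S z = 0 := by
  rw [(harm_spec ⟨z, hz⟩ hAS).1 z hz, Set.indicator_of_notMem hzA]

theorem lap_harm (hS : S.Nonempty) (hAS : A ⊆ S) {z : Γ} (hz : z ∉ S) :
    X.lap (X.harm A S) z = 0 := (harm_spec hS hAS).2 z hz

theorem P_harm (hS : S.Nonempty) (hAS : A ⊆ S) {z : Γ} (hz : z ∉ S) :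
    X.P (X.harm A S) z = X.harm A S z := by
  have := X.lap_apply (X.harm A S) z
  rw [lap_harm hS hAS hz] at this
  linarith

theorem harm_nonneg (hS : S.Nonempty) (hAS : A ⊆ S) (z : Γ) : 0 ≤ X.harm A S z := by
  refine X.comparison hS (f := fun _ => 0) (fun z hz => ?_) (fun z hz => ?_) z
  · rw [lap_const, lap_harm hS hAS hz]
  · rw [(harm_spec hS hAS).1 z hz]
    exact Set.indicator_nonneg (fun _ _ => zero_le_one) z

theorem harm_le_one (hS : S.Nonempty) (hAS : A ⊆ S) (z : Γ) : X.harm A S z ≤ 1 := by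
  refine X.comparison hS (g := fun _ => 1) (fun z hz => ?_) (fun z hz => ?_) z
  · rw [lap_const, lap_harm hS hAS hz]
  · rw [(harm_spec hS hAS).1 z hz]
    exact Set.indicator_le' (fun _ _ => le_rfl) (fun _ _ => zero_le_one) z

theorem harm_unique (hS : S.Nonempty) (hAS : A ⊆ S) {f : Γ → ℝ} (hfA : ∀ z ∈ A, f z = 1)
    (hfS : ∀ z ∈ S, z ∉ A → f z = 0) (hf : ∀ z ∉ S, X.lap f z = 0) : f = X.harm A S := by
  have hb : ∀ z ∈ S, f z = X.harm A S z := by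
    intro z hz
    by_cases hzA : z ∈ A
    · rw [hfA z hzA, harm_of_mem hAS hzA]
    · rw [hfS z hz hzA, harm_of_notMem hAS hz hzA]
  ext z
  refine le_antisymm ?_ ?_
  · exact X.comparison hS (fun z hz => by rw [hf z hz, lap_harm hS hAS hz])
      (fun z hz => (hb z hz).le) z
  · exact X.comparison hS (fun z hz => by rw [hf z hz, lap_harm hS hAS hz])
      (fun z hz => (hb z hz).ge) z

theorem harm_sdiff (hS : S.Nonempty) (hAS : A ⊆ S) (z : Γ) :
    X.harm (S \ A) S z = 1 - X.harm A S z := by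
  have : (fun z => 1 - X.harm A S z) = X.harm (S \ A) S := by
    refine harm_unique hS Set.sdiff_subset (fun z hz => ?_) (fun z hz hzA => ?_) fun z hz => ?_
    · rw [harm_of_notMem hAS hz.1 hz.2, sub_zero]
    · have : z ∈ A := by by_contra h; exact hzA ⟨hz, h⟩
      rw [harm_of_mem hAS this, sub_self]
    · have : (fun z => 1 - X.harm A S z) = (fun _ => 1) - X.harm A S := rfl
      rw [this, map_sub, Pi.sub_apply, lap_const, lap_harm hS hAS hz, sub_self]
  rw [← this]

end Harm

variable (X)

/-- Reversibility as self-adjointness of the generator in `ℓ²(Q)`. All the symmetry and mass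
formulas below are instances of this identity. -/
theorem sum_Q_lap_comm (f g : Γ → ℝ) :
    ∑ z, X.Q z * (f z * X.lap g z) = ∑ z, X.Q z * (g z * X.lap f z) := by
  simp only [lap_apply, P_apply, mul_sub, Finset.sum_sub_distrib, Finset.mul_sum]
  congr 1
  · exact Finset.sum_congr rfl fun z _ => by ring
  · rw [Finset.sum_comm]
    refine Finset.sum_congr rfl fun z _ => Finset.sum_congr rfl fun y _ => ?_
    have := X.reversible y z
    calc X.Q y * (f y * (X.p y z * g z)) = (X.Q y * X.p y z) * (f y * g z) := by ring
      _ = (X.Q z * X.p z y) * (f y * g z) := by rw [this]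
      _ = _ := by ring

theorem Q_pos (x : Γ) : 0 < X.Q x := by
  obtain ⟨y, hy⟩ : ∃ y, 0 < X.Q y := by
    by_contra! h
    have := X.Q_sum
    rw [Finset.sum_eq_zero fun y _ => le_antisymm (h y) (X.Q_nonneg y)] at this
    exact zero_ne_one this
  have hstep : ∀ z, Relation.ReflTransGen (fun v w => 0 < X.p v w) y z → 0 < X.Q z := by
    intro z hz
    induction hz with
    | refl => exact hy
    | @tail v w _ hvw ih =>
      have h1 := X.reversible v w
      have h2 : 0 < X.Q w * X.p w v := by rw [← h1]; exact mul_pos ih hvw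
      exact pos_of_mul_pos_left h2 (X.p_nonneg w v)
  exact hstep x (X.irreducible y x)

variable {X}

section Esc

variable {x : Γ} {J : Set Γ}

theorem harm_self (x : Γ) (J : Set Γ) : X.harm {x} (insert x J) x = 1 :=
  harm_of_mem (singleton_subset_insert x J) rfl

theorem harm_boundary (hx : x ∉ J) {z : Γ} (hz : z ∈ J) : X.harm {x} (insert x J) z = 0 :=
  harm_of_notMem (singleton_subset_insert x J) (Set.mem_insert_of_mem x hz)
    fun h => hx (Set.mem_singleton_iff.1 h ▸ hz)

theorem pot_nonneg (x : Γ) (J : Set Γ) (z : Γ) : 0 ≤ X.harm {x} (insert x J) z :=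
  harm_nonneg (Set.insert_nonempty x J) (singleton_subset_insert x J) z

theorem pot_le_one (x : Γ) (J : Set Γ) (z : Γ) : X.harm {x} (insert x J) z ≤ 1 :=
  harm_le_one (Set.insert_nonempty x J) (singleton_subset_insert x J) z

theorem lap_pot {z : Γ} (hz : z ∉ insert x J) : X.lap (X.harm {x} (insert x J)) z = 0 :=
  lap_harm (Set.insert_nonempty x J) (singleton_subset_insert x J) hz

theorem esc_eq (x : Γ) (J : Set Γ) : X.esc x J = 1 - X.P (X.harm {x} (insert x J)) x := by
  rw [esc, lap_apply, harm_self]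

theorem esc_le_one (x : Γ) (J : Set Γ) : X.esc x J ≤ 1 := by
  rw [esc_eq]
  linarith [X.P_nonneg (pot_nonneg (X := X) x J) x]

theorem esc_pos (hJ : J.Nonempty) (hx : x ∉ J) : 0 < X.esc x J := by
  by_contra! h
  have := X.max_principle hJ (f := X.harm {x} (insert x J)) (fun z hz => ?_)
    (fun z hz => (harm_boundary hx hz).le) x
  · rw [harm_self] at this
    linarith
  · by_cases hzx : z = x
    · rw [hzx]; exact h
    · exact (lap_pot (by simp [hzx, hz])).le

theorem esc_eq_harm (hx : x ∉ J) : X.esc x J = X.P (X.harm J (insert x J)) x := by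
  have h : X.harm J (insert x J) = (fun _ => 1) - X.harm {x} (insert x J) := by
    ext z
    have : J = insert x J \ {x} := by
      rw [Set.insert_sdiff_of_mem _ (Set.mem_singleton x), Set.sdiff_singleton_eq_self hx]
    conv_lhs => enter [2]; rw [this]
    exact harm_sdiff (Set.insert_nonempty x J) (singleton_subset_insert x J) z
  rw [h, map_sub, Pi.sub_apply, P_const, esc_eq]

/-- The potential of `x` transports values of superharmonic functions. -/
theorem pot_mul_le {k : Γ → ℝ} (hx : x ∉ J) (hk : ∀ z, 0 ≤ k z)
    (hlap : ∀ z ∉ J, 0 ≤ X.lap k z) (z : Γ) : X.harm {x} (insert x J) z * k x ≤ k z := by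
  have := X.comparison (Set.insert_nonempty x J) (f := k x • X.harm {x} (insert x J)) (g := k)
    (fun z hz => ?_) (fun z hz => ?_) z
  · simpa [mul_comm] using this
  · rw [map_smul, Pi.smul_apply, lap_pot hz, smul_zero]
    exact hlap z fun h => hz (Set.mem_insert_of_mem x h)
  · rw [Pi.smul_apply, smul_eq_mul]
    rcases hz with rfl | hz
    · rw [harm_self, mul_one]
    · rw [harm_boundary hx hz, mul_zero]
      exact hk z

open Classical in
/-- The effective conductance between two points is symmetric. -/
theorem esc_symm {x y : Γ} (hxy : x ≠ y) : X.Q x * X.esc x {y} = X.Q y * X.esc y {x} := by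
  have hs : ({y} : Set Γ) = insert x {y} \ {x} := by
    rw [Set.insert_sdiff_of_mem _ (Set.mem_singleton x),
      Set.sdiff_singleton_eq_self (by simpa using hxy)]
  have h : X.harm {y} (insert y {x}) = (fun _ => 1) - X.harm {x} (insert x {y}) := by
    ext z
    conv_lhs => enter [2]; rw [hs]
    rw [show (insert y {x} : Set Γ) = insert x {y} from Set.pair_comm y x]
    exact harm_sdiff (Set.insert_nonempty x {y}) (singleton_subset_insert x {y}) z
  -- Tested against constants, the total charge of the potential vanishes. The charge sits only at
  -- `x` and `y`, so the two charges cancel.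
  have h1 := X.sum_Q_lap_comm (fun _ => 1) (X.harm {x} (insert x {y}))
  simp only [lap_const, mul_zero, Finset.sum_const_zero, one_mul] at h1
  rw [← Finset.sum_subset (Finset.subset_univ ({x, y} : Finset Γ)), Finset.sum_pair hxy] at h1
  · have h2 : X.esc y {x} = - X.lap (X.harm {x} (insert x {y})) y := by
      rw [esc, h, map_sub, Pi.sub_apply, lap_const, zero_sub]
    rw [h2, esc]
    linarith
  · intro z _ hz
    rw [lap_pot (by simpa using hz), mul_zero]

end Esc

section Green

variable (X) {J : Set Γ}

open Classical in
/-- The trace of the Green function of the chain killed on `J`. -/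
noncomputable def greenTrace (J : Set Γ) : ℝ := ∑ z, if z ∈ J then 0 else (X.esc z J)⁻¹

open Classical in
/-- The Green potential of `k` for the chain killed on `J`. -/
noncomputable def green (J : Set Γ) (k : Γ → ℝ) : Γ → ℝ :=
  ∑ x, if x ∈ J then 0 else (k x * (X.esc x J)⁻¹) • X.harm {x} (insert x J)

variable {X}

theorem green_apply_of_mem (k : Γ → ℝ) {z : Γ} (hz : z ∈ J) : X.green J k z = 0 := by
  rw [green, Finset.sum_apply]
  refine Finset.sum_eq_zero fun x _ => ?_
  split_ifs with h
  · rfl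
  · rw [Pi.smul_apply, harm_boundary h hz, smul_zero]

/-- Off `J` the potential of `x` has charge `X.esc x J` at `x` and none elsewhere; divided by this
charge it is the column of the Green function at `x`. -/
theorem lap_green (hJ : J.Nonempty) (k : Γ → ℝ) {z : Γ} (hz : z ∉ J) :
    X.lap (X.green J k) z = k z := by
  rw [green, map_sum, Finset.sum_apply, Finset.sum_eq_single z]
  · rw [if_neg hz, map_smul, Pi.smul_apply, ← esc, smul_eq_mul,
      inv_mul_cancel_right₀ (esc_pos hJ hz).ne']
  · intro x _ hxz
    split_ifs with h
    · simp
    · rw [map_smul, Pi.smul_apply, lap_pot (by simp [hxz.symm, hz]), smul_zero]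
  · simp

theorem greenTrace_nonneg (hJ : J.Nonempty) : 0 ≤ X.greenTrace J :=
  Finset.sum_nonneg fun z _ => by
    split_ifs with h
    · rfl
    · exact inv_nonneg.2 (esc_pos hJ h).le

theorem green_nonneg (hJ : J.Nonempty) {k : Γ → ℝ} (hk : ∀ z, 0 ≤ k z) (z : Γ) :
    0 ≤ X.green J k z := by
  rw [green, Finset.sum_apply]
  refine Finset.sum_nonneg fun x _ => ?_
  split_ifs with h
  · rfl
  · exact mul_nonneg (mul_nonneg (hk x) (inv_nonneg.2 (esc_pos hJ h).le)) (pot_nonneg x J z)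

/-- The Green function at `(z, x)` is the potential of `x` at `z` over `X.esc x J`, and by
`pot_mul_le` this potential times `k x` is at most `k z`. Summing over `x` leaves the trace. The
bound is by `k z` rather than by a supremum, so it keeps the decay of `k` near `J`; this is what
produces sub- and super-eigenfunctions later. -/
theorem green_le (hJ : J.Nonempty) {k : Γ → ℝ} (hk : ∀ z, 0 ≤ k z)
    (hlap : ∀ z ∉ J, 0 ≤ X.lap k z) (z : Γ) : X.green J k z ≤ X.greenTrace J * k z := by
  rw [green, Finset.sum_apply, greenTrace, Finset.sum_mul]
  refine Finset.sum_le_sum fun x _ => ?_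
  split_ifs with h
  · simp
  · rw [Pi.smul_apply, smul_eq_mul]
    have h1 := pot_mul_le h hk hlap z
    have h2 := inv_nonneg.2 (esc_pos (X := X) hJ h).le
    calc k x * (X.esc x J)⁻¹ * X.harm {x} (insert x J) z
        = (X.esc x J)⁻¹ * (X.harm {x} (insert x J) z * k x) := by ring
      _ ≤ _ := mul_le_mul_of_nonneg_left h1 h2

end Green

end Potential

end RevChain

/-! ### The killed semigroup and survival probabilities. -/

namespace RevChain

theorem single_eq_zero_of_mem {Γ : Type u} [DecidableEq Γ] {x : Γ} {I : Set Γ} (hx : x ∉ I)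
    {z : Γ} (hz : z ∈ I) : (Pi.single x 1 : Γ → ℝ) z = 0 :=
  Pi.single_eq_of_ne (by rintro rfl; exact hx hz) 1

section Killed

variable {Γ : Type u} [Fintype Γ] (X : RevChain Γ)

open Classical in
/-- The transition operator of the chain killed on `I`. -/
noncomputable def killed (I : Set Γ) : Module.End ℝ (Γ → ℝ) where
  toFun f z := if z ∈ I then 0 else X.P f z
  map_add' f g := by ext z; by_cases h : z ∈ I <;> simp [h]
  map_smul' c f := by ext z; by_cases h : z ∈ I <;> simp [h]

variable {X} {I : Set Γ}

theorem killed_of_mem {z : Γ} (hz : z ∈ I) (f : Γ → ℝ) : X.killed I f z = 0 := if_pos hz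

theorem killed_of_notMem {z : Γ} (hz : z ∉ I) (f : Γ → ℝ) : X.killed I f z = X.P f z := if_neg hz

theorem killed_mono {f g : Γ → ℝ} (h : ∀ z, f z ≤ g z) (z : Γ) :
    X.killed I f z ≤ X.killed I g z := by
  by_cases hz : z ∈ I
  · rw [killed_of_mem hz, killed_of_mem hz]
  · rw [killed_of_notMem hz, killed_of_notMem hz]
    exact X.P_mono h z

theorem killed_pow_succ (n : ℕ) (f : Γ → ℝ) :
    (X.killed I ^ (n + 1)) f = X.killed I ((X.killed I ^ n) f) := by
  rw [pow_succ']; rfl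

theorem killed_pow_succ' (n : ℕ) (f : Γ → ℝ) :
    (X.killed I ^ (n + 1)) f = (X.killed I ^ n) (X.killed I f) := by
  rw [pow_succ]; rfl

theorem killed_pow_mono (n : ℕ) {f g : Γ → ℝ} (h : ∀ z, f z ≤ g z) (z : Γ) :
    (X.killed I ^ n) f z ≤ (X.killed I ^ n) g z := by
  induction n generalizing z with
  | zero => exact h z
  | succ n ih =>
    rw [killed_pow_succ, killed_pow_succ]
    exact killed_mono ih z

theorem killed_pow_nonneg (n : ℕ) {f : Γ → ℝ} (h : ∀ z, 0 ≤ f z) (z : Γ) :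
    0 ≤ (X.killed I ^ n) f z := by
  have := killed_pow_mono (X := X) (I := I) n (f := 0) h z
  simpa using this

theorem killed_pow_of_mem (n : ℕ) {f : Γ → ℝ} (hf : ∀ z ∈ I, f z = 0) {z : Γ} (hz : z ∈ I) :
    (X.killed I ^ n) f z = 0 := by
  cases n with
  | zero => exact hf z hz
  | succ n => rw [killed_pow_succ, killed_of_mem hz]

theorem killed_pow_le_geom (n : ℕ) {f : Γ → ℝ} {c : ℝ} (hc : 0 ≤ c)
    (h : ∀ z, X.killed I f z ≤ c * f z) (z : Γ) : (X.killed I ^ n) f z ≤ c ^ n * f z := by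
  induction n with
  | zero => simp
  | succ n ih =>
    rw [killed_pow_succ']
    have h1 := killed_pow_mono (X := X) (I := I) n (g := c • f) h z
    rw [map_smul, Pi.smul_apply, smul_eq_mul] at h1
    calc _ ≤ _ := h1
      _ ≤ c * (c ^ n * f z) := mul_le_mul_of_nonneg_left ih hc
      _ = _ := by ring

theorem geom_le_killed_pow (n : ℕ) {f : Γ → ℝ} {c : ℝ} (hc : 0 ≤ c)
    (h : ∀ z, c * f z ≤ X.killed I f z) (z : Γ) : c ^ n * f z ≤ (X.killed I ^ n) f z := by
  induction n with
  | zero => simp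
  | succ n ih =>
    rw [killed_pow_succ']
    have h1 := killed_pow_mono (X := X) (I := I) n (f := c • f) h z
    rw [map_smul, Pi.smul_apply, smul_eq_mul] at h1
    calc _ = c * (c ^ n * f z) := by ring
      _ ≤ _ := mul_le_mul_of_nonneg_left ih hc
      _ ≤ _ := h1

theorem sum_Q_killed_comm {f g : Γ → ℝ} (hf : ∀ z ∈ I, f z = 0) (hg : ∀ z ∈ I, g z = 0) :
    ∑ z, X.Q z * (f z * X.killed I g z) = ∑ z, X.Q z * (g z * X.killed I f z) := by
  have h := X.sum_Q_lap_comm f g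
  simp only [lap_apply, mul_sub, Finset.sum_sub_distrib] at h
  have h1 : ∀ f g : Γ → ℝ, (∀ z ∈ I, f z = 0) →
      ∑ z, X.Q z * (f z * X.killed I g z) = ∑ z, X.Q z * (f z * X.P g z) := by
    intro f g hf
    refine Finset.sum_congr rfl fun z _ => ?_
    by_cases hz : z ∈ I
    · rw [hf z hz]; simp
    · rw [killed_of_notMem hz]
  rw [h1 f g hf, h1 g f hg]
  have h2 : ∑ z, X.Q z * (f z * g z) = ∑ z, X.Q z * (g z * f z) :=
    Finset.sum_congr rfl fun z _ => by ring
  linarith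

theorem sum_Q_killed_pow_comm (n : ℕ) {f g : Γ → ℝ} (hf : ∀ z ∈ I, f z = 0)
    (hg : ∀ z ∈ I, g z = 0) :
    ∑ z, X.Q z * (f z * (X.killed I ^ n) g z) = ∑ z, X.Q z * (g z * (X.killed I ^ n) f z) := by
  induction n generalizing f with
  | zero => exact Finset.sum_congr rfl fun z _ => by simp [mul_comm]
  | succ n ih =>
    rw [killed_pow_succ, sum_Q_killed_comm hf fun z hz => killed_pow_of_mem n hg hz,
      killed_pow_succ' n f, ← ih fun z hz => killed_of_mem hz f]
    exact Finset.sum_congr rfl fun z _ => by ring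

variable (X I) in
/-- The probability `P[τ_I > n]` for the chain started off `I`. -/
noncomputable def surv (n : ℕ) : Γ → ℝ := (X.killed I ^ n) (Iᶜ.indicator fun _ => 1)

theorem surv_nonneg (n : ℕ) (z : Γ) : 0 ≤ X.surv I n z :=
  killed_pow_nonneg n (fun _ => Set.indicator_nonneg (fun _ _ => zero_le_one) _) z

theorem surv_of_mem (n : ℕ) {z : Γ} (hz : z ∈ I) : X.surv I n z = 0 :=
  killed_pow_of_mem n (fun _ hz => Set.indicator_of_notMem (Set.notMem_compl_iff.2 hz) _) hz

theorem surv_zero {z : Γ} (hz : z ∉ I) : X.surv I 0 z = 1 :=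
  Set.indicator_of_mem (show z ∈ Iᶜ from hz) fun _ => (1 : ℝ)

theorem surv_succ (n : ℕ) {z : Γ} (hz : z ∉ I) : X.surv I (n + 1) z = X.P (X.surv I n) z := by
  rw [surv, killed_pow_succ, killed_of_notMem hz]; rfl

theorem surv_antitone (z : Γ) : Antitone fun n => X.surv I n z := by
  refine antitone_nat_of_succ_le fun n => ?_
  rw [surv, killed_pow_succ']
  refine killed_pow_mono n (fun z => ?_) z
  by_cases hz : z ∈ I
  · rw [killed_of_mem hz]
    exact Set.indicator_nonneg (fun _ _ => zero_le_one) _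
  · rw [killed_of_notMem hz, Set.indicator_of_mem (show z ∈ Iᶜ from hz)]
    calc X.P (Iᶜ.indicator fun _ => 1) z ≤ X.P (fun _ => 1) z :=
          X.P_mono (fun y => Set.indicator_le' (fun _ _ => le_rfl) (fun _ _ => zero_le_one) y) z
      _ = 1 := X.P_const 1 z

theorem surv_le_one (n : ℕ) (z : Γ) : X.surv I n z ≤ 1 :=
  (surv_antitone z (Nat.zero_le n)).trans
    (Set.indicator_le' (fun _ _ => le_rfl) (fun _ _ => zero_le_one) z)

theorem exists_mean (hI : I.Nonempty) :
    ∃ u : Γ → ℝ, (∀ z ∈ I, u z = 0) ∧ ∀ z ∉ I, X.lap u z = 1 := by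
  obtain ⟨u, h1, h2⟩ := X.exists_dirichlet hI (Iᶜ.indicator fun _ => 1)
  refine ⟨u, fun z hz => ?_, fun z hz => ?_⟩
  · rw [h1 z hz, Set.indicator_of_notMem (Set.notMem_compl_iff.2 hz)]
  · rw [h2 z hz, Set.indicator_of_mem (show z ∈ Iᶜ from hz)]

/-- Telescoping for the killed chain. -/
theorem sum_killed_pow (n : ℕ) {f g : Γ → ℝ} (h : f = g - X.killed I g) :
    ∑ k ∈ Finset.range n, (X.killed I ^ k) f = g - (X.killed I ^ n) g := by
  induction n with
  | zero => simp
  | succ n ih =>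
    rw [Finset.sum_range_succ, ih, h, map_sub, ← killed_pow_succ']
    abel

theorem sum_surv {u : Γ → ℝ} (hu : ∀ z ∈ I, u z = 0)
    (hlap : ∀ z ∉ I, X.lap u z = 1) (n : ℕ) (z : Γ) :
    ∑ k ∈ Finset.range n, X.surv I k z = u z - (X.killed I ^ n) u z := by
  have h : (Iᶜ.indicator fun _ => 1) = u - X.killed I u := by
    ext z
    by_cases hz : z ∈ I
    · rw [Set.indicator_of_notMem (Set.notMem_compl_iff.2 hz), Pi.sub_apply, killed_of_mem hz, hu z hz, sub_zero]
    · rw [Set.indicator_of_mem (show z ∈ Iᶜ from hz), Pi.sub_apply, killed_of_notMem hz,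
        ← lap_apply, hlap z hz]
  have := congrFun (sum_killed_pow n h) z
  rwa [Finset.sum_apply] at this

/-- The partial sums telescope to `u` minus a remainder and are bounded by `u`. As `u` is at most a
constant off `I` and zero on `I`, the remainder is at most that constant times the survival
probability, which tends to zero by the summability just obtained. -/
theorem hasSum_surv (hI : I.Nonempty) {u : Γ → ℝ} (hu : ∀ z ∈ I, u z = 0)
    (hlap : ∀ z ∉ I, X.lap u z = 1) (z : Γ) : HasSum (fun n => X.surv I n z) (u z) := by
  have hu0 : ∀ z, 0 ≤ u z := X.comparison hI (f := fun _ => 0)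
    (fun z hz => by rw [lap_const, hlap z hz]; exact zero_le_one) fun z hz => (hu z hz).ge
  have hsum : Summable fun n => X.surv I n z :=
    summable_of_sum_range_le (c := u z) (fun n => surv_nonneg n z) fun n => by
      rw [sum_surv hu hlap]
      linarith [killed_pow_nonneg (X := X) (I := I) n hu0 z]
  obtain ⟨C, hC⟩ : ∃ C, ∀ z, u z ≤ C := by
    obtain ⟨w, hw⟩ := @Finite.exists_max _ _ _ ⟨z⟩ _ u
    exact ⟨u w, hw⟩
  have hlim : Tendsto (fun n => (X.killed I ^ n) u z) atTop (𝓝 0) := by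
    refine tendsto_of_tendsto_of_tendsto_of_le_of_le tendsto_const_nhds
      (h := fun n => C * X.surv I n z) ?_ (fun n => killed_pow_nonneg n hu0 z) fun n => ?_
    · simpa using hsum.tendsto_atTop_zero.const_mul C
    · have h := killed_pow_mono (X := X) (I := I) n (f := u) (g := C • Iᶜ.indicator fun _ => 1)
        (fun z => ?_) z
      · rw [map_smul] at h; exact h
      · by_cases hz : z ∈ I
        · simp [hz, hu z hz]
        · simp [hz, hC z]
  rw [hsum.hasSum_iff_tendsto_nat]
  simp only [sum_surv hu hlap]
  simpa using hlim.const_sub (u z)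

end Killed

/-! ### The approximate eigenfunction and geometric bounds on survival. -/

section ExponentialLaw

variable {Γ : Type u} [Fintype Γ] (X : RevChain Γ) (I : Set Γ) (x : Γ)

/-- The normalized squared norm of the equilibrium potential. -/
noncomputable def potSq : ℝ := (∑ z, X.Q z * X.harm {x} (insert x I) z ^ 2) / X.Q x

/-- The normalized integral of the equilibrium potential. -/
noncomputable def potMass : ℝ := (∑ z, X.Q z * X.harm {x} (insert x I) z) / X.Q x

/-- The equilibrium potential corrected to an approximate eigenfunction of the killed chain. -/
noncomputable def quasiEigen : Γ → ℝ :=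
  X.harm {x} (insert x I) +
    (X.esc x I / X.potSq I x) • X.green (insert x I) (X.harm {x} (insert x I))

variable {X I x}

theorem one_le_potSq : 1 ≤ X.potSq I x := by
  rw [potSq, le_div_iff₀ (X.Q_pos x), one_mul]
  have := Finset.single_le_sum (f := fun z => X.Q z * X.harm {x} (insert x I) z ^ 2)
    (fun z _ => mul_nonneg (X.Q_nonneg z) (sq_nonneg _)) (Finset.mem_univ x)
  simpa [harm_self] using this

theorem lap_pot_nonneg (hI : I.Nonempty) (hx : x ∉ I) {z : Γ} (hz : z ∉ I) :
    0 ≤ X.lap (X.harm {x} (insert x I)) z := by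
  by_cases hzx : z = x
  · rw [hzx]; exact (esc_pos hI hx).le
  · rw [lap_pot (by simp [hzx, hz])]

theorem sum_Q_pot_lap {g : Γ → ℝ} (hg : ∀ z ∈ I, g z = 0) :
    ∑ z, X.Q z * (X.harm {x} (insert x I) z * X.lap g z) = X.Q x * (g x * X.esc x I) := by
  rw [sum_Q_lap_comm, Finset.sum_eq_single x]
  · rfl
  · intro z _ hzx
    by_cases hz : z ∈ I
    · rw [hg z hz]; simp
    · rw [lap_pot (by simp [hzx, hz])]; simp
  · simp

-- Pair `e` with the generator applied to its Green potential. The pairing vanishes, because the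
-- Green potential is zero at `x` and on `I` while `e` is harmonic elsewhere. Off `I ∪ {x}` the
-- integrand is `Q * e ^ 2`, so the term at `x` must balance `potSq - 1`.
open Classical in
theorem lap_green_pot_self (hx : x ∉ I) :
    X.lap (X.green (insert x I) (X.harm {x} (insert x I))) x = 1 - X.potSq I x := by
  have hJ : (insert x I).Nonempty := Set.insert_nonempty x I
  have h := sum_Q_pot_lap (X := X) (x := x) (g := X.green (insert x I) (X.harm {x} (insert x I)))
    fun z hz => green_apply_of_mem _ (Set.mem_insert_of_mem x hz)
  rw [green_apply_of_mem _ (Set.mem_insert x I), zero_mul, mul_zero] at h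
  have h2 : ∀ z, X.Q z * (X.harm {x} (insert x I) z *
      X.lap (X.green (insert x I) (X.harm {x} (insert x I))) z) =
      X.Q z * X.harm {x} (insert x I) z ^ 2 + if z = x then
        X.Q x * (X.lap (X.green (insert x I) (X.harm {x} (insert x I))) x - 1) else 0 := by
    intro z
    by_cases hzx : z = x
    · rw [if_pos hzx, hzx, harm_self]; ring
    · rw [if_neg hzx]
      by_cases hz : z ∈ I
      · rw [harm_boundary hx hz]; ring
      · rw [lap_green hJ _ (by simp [hzx, hz])]; ring
  rw [Finset.sum_congr rfl fun z _ => h2 z, Finset.sum_add_distrib, Finset.sum_ite_eq'] at h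
  have hQ := X.Q_pos x
  have h3 : ∑ z, X.Q z * X.harm {x} (insert x I) z ^ 2 = X.potSq I x * X.Q x := by
    rw [potSq, div_mul_cancel₀ _ hQ.ne']
  rw [h3, if_pos (Finset.mem_univ x)] at h
  have h4 : X.Q x * (X.potSq I x +
      (X.lap (X.green (insert x I) (X.harm {x} (insert x I))) x - 1)) = 0 := by linarith
  rcases mul_eq_zero.1 h4 with h5 | h5
  · exact absurd h5 hQ.ne'
  · linarith

-- The left side is the normalised pairing of `e` with `h = 1 - e`. Balancing charges as for
-- `lap_green_pot_self` turns it into one step from `x` of the Green potential of `h`. Since `h` is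
-- nonnegative and harmonic off `I ∪ {x}`, `green_le` applies, and one step of `h` from `x` is the
-- escape probability.
open Classical in
theorem potMass_sub_potSq_le (hx : x ∉ I) :
    X.potMass I x - X.potSq I x ≤ X.esc x I * X.greenTrace (insert x I) := by
  have hJ : (insert x I).Nonempty := Set.insert_nonempty x I
  have hIJ : I ⊆ insert x I := Set.subset_insert x I
  set h := X.harm I (insert x I) with hh
  have hh0 : ∀ z, 0 ≤ h z := harm_nonneg hJ hIJ
  have he : ∀ z, h z = 1 - X.harm {x} (insert x I) z := by
    intro z
    have : I = insert x I \ {x} := by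
      rw [Set.insert_sdiff_of_mem _ (Set.mem_singleton x), Set.sdiff_singleton_eq_self hx]
    rw [hh]
    conv_lhs => enter [2]; rw [this]
    exact harm_sdiff hJ (singleton_subset_insert x I) z
  have h1 := sum_Q_pot_lap (X := X) (x := x) (g := X.green (insert x I) h)
    fun z hz => green_apply_of_mem _ (Set.mem_insert_of_mem x hz)
  rw [green_apply_of_mem _ (Set.mem_insert x I), zero_mul, mul_zero] at h1
  have h2 : ∀ z, X.Q z * (X.harm {x} (insert x I) z * X.lap (X.green (insert x I) h) z) =
      (X.Q z * X.harm {x} (insert x I) z - X.Q z * X.harm {x} (insert x I) z ^ 2) +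
        if z = x then X.Q x * X.lap (X.green (insert x I) h) x else 0 := by
    intro z
    by_cases hzx : z = x
    · rw [if_pos hzx, hzx, harm_self]; ring
    · rw [if_neg hzx]
      by_cases hz : z ∈ I
      · rw [harm_boundary hx hz]; ring
      · rw [lap_green hJ _ (by simp [hzx, hz]), he]; ring
  rw [Finset.sum_congr rfl fun z _ => h2 z, Finset.sum_add_distrib, Finset.sum_ite_eq',
    if_pos (Finset.mem_univ x), Finset.sum_sub_distrib] at h1
  have hQ := X.Q_pos x
  have h3 : X.lap (X.green (insert x I) h) x = - X.P (X.green (insert x I) h) x := by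
    rw [lap_apply, green_apply_of_mem _ (Set.mem_insert x I), zero_sub]
  have h4 : X.P (X.green (insert x I) h) x ≤ X.greenTrace (insert x I) * X.esc x I := by
    have := X.P_mono (f := X.green (insert x I) h) (g := X.greenTrace (insert x I) • h)
      (green_le hJ hh0 fun z hz => (lap_harm hJ hIJ hz).ge) x
    rwa [map_smul, Pi.smul_apply, smul_eq_mul, hh, ← esc_eq_harm hx] at this
  rw [potMass, potSq, ← sub_div, div_le_iff₀ hQ]
  nlinarith

/-- Green's identity between `e` and the mean hitting time `u`: the mean is the mass of the
equilibrium potential over the capacity. -/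
theorem esc_mul_mean {u : Γ → ℝ} (hx : x ∉ I) (hu : ∀ z ∈ I, u z = 0)
    (hlap : ∀ z ∉ I, X.lap u z = 1) : X.esc x I * u x = X.potMass I x := by
  have h := sum_Q_pot_lap (X := X) (x := x) hu
  have h2 : ∀ z, X.Q z * (X.harm {x} (insert x I) z * X.lap u z) =
      X.Q z * X.harm {x} (insert x I) z := by
    intro z
    by_cases hz : z ∈ I
    · rw [harm_boundary hx hz]; ring
    · rw [hlap z hz, mul_one]
  rw [Finset.sum_congr rfl fun z _ => h2 z] at h
  rw [potMass, h, eq_div_iff (X.Q_pos x).ne']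
  ring

theorem potSq_le_potMass : X.potSq I x ≤ X.potMass I x := by
  refine div_le_div_of_nonneg_right (Finset.sum_le_sum fun z _ => ?_) (X.Q_nonneg x)
  refine mul_le_mul_of_nonneg_left ?_ (X.Q_nonneg z)
  have h0 := pot_nonneg (X := X) x I z
  have h1 := pot_le_one (X := X) x I z
  nlinarith

section QuasiEigen

theorem rate_nonneg (hI : I.Nonempty) (hx : x ∉ I) : 0 ≤ X.esc x I / X.potSq I x :=
  div_nonneg (esc_pos hI hx).le (zero_le_one.trans one_le_potSq)

theorem rate_le_one : X.esc x I / X.potSq I x ≤ 1 := by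
  rw [div_le_one (zero_lt_one.trans_le one_le_potSq)]
  exact (esc_le_one x I).trans one_le_potSq

theorem green_pot_le (hI : I.Nonempty) (hx : x ∉ I) (z : Γ) :
    X.green (insert x I) (X.harm {x} (insert x I)) z ≤
      X.greenTrace (insert x I) * X.harm {x} (insert x I) z :=
  green_le (Set.insert_nonempty x I) (pot_nonneg x I)
    (fun _ hz => lap_pot_nonneg hI hx fun h => hz (Set.mem_insert_of_mem x h)) z

theorem pot_le_quasiEigen (hI : I.Nonempty) (hx : x ∉ I) (z : Γ) :
    X.harm {x} (insert x I) z ≤ X.quasiEigen I x z := by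
  have h1 := green_nonneg (X := X) (Set.insert_nonempty x I) (pot_nonneg (X := X) x I) z
  have h2 := mul_nonneg (rate_nonneg (X := X) hI hx) h1
  simp only [quasiEigen, Pi.add_apply, Pi.smul_apply, smul_eq_mul]
  linarith

theorem quasiEigen_le (hI : I.Nonempty) (hx : x ∉ I) (z : Γ) :
    X.quasiEigen I x z ≤ (1 + X.esc x I / X.potSq I x * X.greenTrace (insert x I)) *
      X.harm {x} (insert x I) z := by
  have h2 := mul_le_mul_of_nonneg_left (green_pot_le (X := X) hI hx z)
    (rate_nonneg (X := X) hI hx)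
  simp only [quasiEigen, Pi.add_apply, Pi.smul_apply, smul_eq_mul]
  linarith

theorem quasiEigen_self : X.quasiEigen I x x = 1 := by
  simp [quasiEigen, harm_self, green_apply_of_mem]

theorem quasiEigen_of_mem (hx : x ∉ I) {z : Γ} (hz : z ∈ I) : X.quasiEigen I x z = 0 := by
  simp [quasiEigen, harm_boundary hx hz, green_apply_of_mem _ (Set.mem_insert_of_mem x hz)]

/-- The rate `λ = esc / potSq` is the solution of `esc + λ (1 - potSq) = λ`, the equation at `x`. At
the other points off `I` the potential is harmonic and its Green potential supplies the right-hand
side. -/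
theorem lap_quasiEigen (hx : x ∉ I) {z : Γ} (hz : z ∉ I) :
    X.lap (X.quasiEigen I x) z = X.esc x I / X.potSq I x * X.harm {x} (insert x I) z := by
  have hB : X.potSq I x ≠ 0 := (zero_lt_one.trans_le one_le_potSq).ne'
  rw [quasiEigen, map_add, map_smul, Pi.add_apply, Pi.smul_apply, smul_eq_mul]
  by_cases hzx : z = x
  · rw [hzx, lap_green_pot_self hx, harm_self, ← esc]
    field_simp
    ring
  · have : z ∉ insert x I := by simp [hzx, hz]
    rw [lap_pot this, lap_green (Set.insert_nonempty x I) _ this, zero_add]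

/-- In `lap_quasiEigen` the source is `e`, not the function itself. Replacing it through
`pot_le_quasiEigen` here, and through `quasiEigen_le` in the next lemma, costs only the factor `1 +
λD` between the two rates. -/
theorem killed_quasiEigen_ge (hI : I.Nonempty) (hx : x ∉ I) (z : Γ) :
    (1 - X.esc x I / X.potSq I x) * X.quasiEigen I x z ≤ X.killed I (X.quasiEigen I x) z := by
  by_cases hz : z ∈ I
  · rw [quasiEigen_of_mem hx hz, killed_of_mem hz, mul_zero]
  · rw [killed_of_notMem hz]
    have h1 := lap_quasiEigen (X := X) hx hz
    have h2 := mul_le_mul_of_nonneg_left (pot_le_quasiEigen (X := X) hI hx z)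
      (rate_nonneg (X := X) hI hx)
    rw [lap_apply] at h1
    linarith

theorem killed_quasiEigen_le (hI : I.Nonempty) (hx : x ∉ I) (z : Γ) :
    X.killed I (X.quasiEigen I x) z ≤ (1 - X.esc x I / X.potSq I x /
      (1 + X.esc x I / X.potSq I x * X.greenTrace (insert x I))) * X.quasiEigen I x z := by
  by_cases hz : z ∈ I
  · rw [quasiEigen_of_mem hx hz, killed_of_mem hz, mul_zero]
  · rw [killed_of_notMem hz]
    have h1 := lap_quasiEigen (X := X) hx hz
    have h0 := rate_nonneg (X := X) hI hx
    have hD := greenTrace_nonneg (X := X) (Set.insert_nonempty x I)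
    have hpos : 0 < 1 + X.esc x I / X.potSq I x * X.greenTrace (insert x I) := by positivity
    have h3 : X.quasiEigen I x z / (1 + X.esc x I / X.potSq I x * X.greenTrace (insert x I)) ≤
        X.harm {x} (insert x I) z := by
      rw [div_le_iff₀ hpos, mul_comm]
      exact quasiEigen_le hI hx z
    have h2 := mul_le_mul_of_nonneg_left h3 h0
    rw [lap_apply] at h1
    have h4 : (1 - X.esc x I / X.potSq I x /
      (1 + X.esc x I / X.potSq I x * X.greenTrace (insert x I))) * X.quasiEigen I x z =
      X.quasiEigen I x z - X.esc x I / X.potSq I x * (X.quasiEigen I x z /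
        (1 + X.esc x I / X.potSq I x * X.greenTrace (insert x I))) := by ring
    rw [h4]
    linarith

end QuasiEigen

theorem surv_lower (hI : I.Nonempty) (hx : x ∉ I) (n : ℕ) :
    (1 - X.esc x I / X.potSq I x) ^ n ≤
      (1 + X.esc x I / X.potSq I x * X.greenTrace (insert x I)) * X.surv I n x := by
  have h1 := geom_le_killed_pow (X := X) (I := I) n (sub_nonneg.2 rate_le_one)
    (killed_quasiEigen_ge hI hx) x
  rw [quasiEigen_self, mul_one] at h1
  refine h1.trans ?_
  have h2 := killed_pow_mono (X := X) (I := I) n (f := X.quasiEigen I x)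
    (g := (1 + X.esc x I / X.potSq I x * X.greenTrace (insert x I)) • Iᶜ.indicator fun _ => 1)
    (fun z => ?_) x
  · rw [map_smul] at h2; exact h2
  · by_cases hz : z ∈ I
    · simp [quasiEigen_of_mem hx hz, hz]
    · have h0 := rate_nonneg (X := X) hI hx
      have hD := greenTrace_nonneg (X := X) (Set.insert_nonempty x I)
      have h3 := quasiEigen_le (X := X) hI hx z
      have h4 : 0 ≤ 1 + X.esc x I / X.potSq I x * X.greenTrace (insert x I) := by positivity
      have h5 := mul_le_mul_of_nonneg_left (pot_le_one (X := X) x I z) h4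
      simp only [Pi.smul_apply, smul_eq_mul, Set.indicator_of_mem (show z ∈ Iᶜ from hz)]
      linarith

section Window

open Classical in
variable (X I x) in
/-- The expected number of visits to `x` before time `L` and before `I` is visited. -/
noncomputable def visits (L : ℕ) : Γ → ℝ :=
  ∑ j ∈ Finset.range L, (X.killed I ^ j) (Pi.single x 1)

-- Starting from `z`, visits can only be counted after `x` has been reached before `I`.
-- Analytically, the truncation at `L` leaves a nonpositive source off `I ∪ {x}`, so the comparison
-- principle applies.
open Classical in
theorem visits_le (hx : x ∉ I) (L : ℕ) (z : Γ) :
    X.visits I x L z ≤ X.visits I x L x * X.harm {x} (insert x I) z := by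
  have hK : X.killed I (X.visits I x L) =
      X.visits I x L - Pi.single x 1 + (X.killed I ^ L) (Pi.single x 1) := by
    rw [visits, map_sum]
    simp only [← killed_pow_succ]
    have := Finset.sum_range_succ' (fun j => (X.killed I ^ j) (Pi.single x 1)) L
    rw [Finset.sum_range_succ] at this
    simp only [pow_zero, Module.End.one_apply] at this
    rw [eq_comm, ← sub_eq_zero]
    linear_combination (exp := 1) this
  have h := X.comparison (Set.insert_nonempty x I) (f := X.visits I x L)
    (g := X.visits I x L x • X.harm {x} (insert x I)) (fun z hz => ?_) (fun z hz => ?_) z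
  · simpa using h
  · have hzI : z ∉ I := fun h => hz (Set.mem_insert_of_mem x h)
    have hzx : z ≠ x := fun h => hz (h ▸ Set.mem_insert x I)
    rw [map_smul, Pi.smul_apply, lap_pot hz, smul_zero, lap_apply, ← killed_of_notMem hzI, hK]
    have h0 := killed_pow_nonneg (X := X) (I := I) L (f := Pi.single x 1)
      (fun z => by by_cases h : z = x <;> simp [h]) z
    simp only [Pi.add_apply, Pi.sub_apply, Pi.single_eq_of_ne hzx]
    linarith
  · rcases hz with rfl | hz
    · simp [harm_self]
    · rw [visits, Finset.sum_apply, Finset.sum_eq_zero fun j _ =>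
        killed_pow_of_mem j (fun z hz => single_eq_zero_of_mem hx hz) hz, Pi.smul_apply,
        harm_boundary hx hz, smul_zero]

-- By `lap_green_pot_self`, `e - potSq • 1_x` is `g - K g` for the Green potential `g` of `e`.
-- Telescoping over `L` steps and evaluating at `x`, where `g` vanishes, leaves at most `L` from `e`
-- and at most the trace from the end term.
open Classical in
theorem potSq_mul_visits_le (hI : I.Nonempty) (hx : x ∉ I) (L : ℕ) :
    X.potSq I x * X.visits I x L x ≤ L + X.greenTrace (insert x I) := by
  set e := X.harm {x} (insert x I) with he
  set g := X.green (insert x I) e with hg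
  have hgK : e - X.potSq I x • Pi.single x 1 = g - X.killed I g := by
    ext z
    simp only [Pi.sub_apply, Pi.smul_apply, smul_eq_mul]
    by_cases hz : z ∈ I
    · rw [killed_of_mem hz, he, harm_boundary hx hz, single_eq_zero_of_mem hx hz, hg,
        green_apply_of_mem _ (Set.mem_insert_of_mem x hz), mul_zero]
    · rw [killed_of_notMem hz, ← lap_apply]
      by_cases hzx : z = x
      · rw [hzx, hg, he, lap_green_pot_self hx, harm_self, Pi.single_eq_same, mul_one]
      · rw [Pi.single_eq_of_ne hzx, mul_zero, sub_zero, hg,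
          lap_green (Set.insert_nonempty x I) _ (by simp [hzx, hz])]
  have h := congrFun (sum_killed_pow (X := X) L hgK) x
  simp only [map_sub, map_smul, Finset.sum_sub_distrib, ← Finset.smul_sum] at h
  rw [← visits] at h
  simp only [Pi.sub_apply, Pi.smul_apply, smul_eq_mul, Finset.sum_apply] at h
  have hgx : g x = 0 := green_apply_of_mem _ (Set.mem_insert x I)
  have he1 : ∀ z, e z ≤ Iᶜ.indicator (fun _ => 1) z := by
    intro z
    by_cases hz : z ∈ I
    · rw [he, harm_boundary hx hz]; exact Set.indicator_nonneg (fun _ _ => zero_le_one) _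
    · rw [Set.indicator_of_mem (show z ∈ Iᶜ from hz)]; exact pot_le_one x I z
  have h1 : ∑ k ∈ Finset.range L, (X.killed I ^ k) e x ≤ L := by
    calc ∑ k ∈ Finset.range L, (X.killed I ^ k) e x ≤ ∑ k ∈ Finset.range L, (1 : ℝ) :=
          Finset.sum_le_sum fun k _ => (killed_pow_mono k he1 x).trans (surv_le_one k x)
      _ = L := by simp
  have h2 : (X.killed I ^ L) g x ≤ X.greenTrace (insert x I) := by
    have h3 := killed_pow_mono (X := X) (I := I) L (f := g)
      (g := X.greenTrace (insert x I) • Iᶜ.indicator fun _ => 1) (fun z => ?_) x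
    · rw [map_smul] at h3
      have h4 := mul_le_mul_of_nonneg_left (surv_le_one (X := X) (I := I) L x)
        (greenTrace_nonneg (X := X) (Set.insert_nonempty x I))
      rw [mul_one] at h4
      exact h3.trans h4
    · exact (green_pot_le hI hx z).trans (mul_le_mul_of_nonneg_left (he1 z)
        (greenTrace_nonneg (X := X) (Set.insert_nonempty x I)))
  linarith

-- Off `I`, split `1 = e + h`. The part `e` lies below `quasiEigen` and decays geometrically. For
-- `h`, reversibility turns the sum over the window into a pairing of `h` with the visit count after
-- `m` killed steps. That count lies below a multiple of `quasiEigen`, which yields the geometric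
-- decay and the small factor `potMass - potSq`.
open Classical in
theorem sum_surv_window_le (hI : I.Nonempty) (hx : x ∉ I) {θ s : ℝ}
    (hs : s = 1 + X.esc x I / X.potSq I x * X.greenTrace (insert x I))
    (hθ : θ = X.esc x I / X.potSq I x / s) (m L : ℕ) :
    ∑ k ∈ Finset.range L, X.surv I (k + m) x ≤
      (1 - θ) ^ m * (L + X.visits I x L x * s * (X.potMass I x - X.potSq I x)) := by
  set e := X.harm {x} (insert x I) with he
  set v := X.quasiEigen I x with hv
  have h0 := rate_nonneg (X := X) hI hx
  have hD := greenTrace_nonneg (X := X) (Set.insert_nonempty x I)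
  have hs1 : 1 ≤ s := by rw [hs]; linarith [mul_nonneg h0 hD]
  have hs0 : 0 < s := zero_lt_one.trans_le hs1
  have hθ0 : 0 ≤ θ := by rw [hθ]; exact div_nonneg h0 hs0.le
  have hθ1 : θ ≤ 1 := by
    rw [hθ, div_le_one hs0]; exact rate_le_one.trans hs1
  have hgeom : ∀ n z, (X.killed I ^ n) v z ≤ (1 - θ) ^ n * v z := fun n z =>
    killed_pow_le_geom n (sub_nonneg.2 hθ1)
      (fun z => by rw [hθ, hs]; exact killed_quasiEigen_le hI hx z) z
  set h : Γ → ℝ := (Iᶜ.indicator fun _ => 1) - e with hh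
  have hhI : ∀ z ∈ I, h z = 0 := fun z hz => by
    rw [hh, Pi.sub_apply, Set.indicator_of_notMem (Set.notMem_compl_iff.2 hz), he, harm_boundary hx hz, sub_zero]
  have hhz : ∀ z ∉ I, h z = 1 - e z := fun z hz => by
    rw [hh, Pi.sub_apply, Set.indicator_of_mem (show z ∈ Iᶜ from hz)]
  have hh0 : ∀ z, 0 ≤ h z := by
    intro z
    by_cases hz : z ∈ I
    · rw [hhI z hz]
    · rw [hhz z hz]; linarith [pot_le_one (X := X) x I z]
  have hsplit : ∀ k, X.surv I (k + m) x ≤ (1 - θ) ^ m + (X.killed I ^ (k + m)) h x := by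
    intro k
    have h1 := killed_pow_mono (X := X) (I := I) (k + m) (f := Iᶜ.indicator fun _ => 1)
      (g := v + h) (fun z => by
        have := pot_le_quasiEigen (X := X) hI hx z
        rw [Pi.add_apply, hh, Pi.sub_apply]
        linarith) x
    rw [map_add, Pi.add_apply] at h1
    have h2 := hgeom (k + m) x
    rw [hv, quasiEigen_self, mul_one] at h2
    have h3 : (1 - θ) ^ (k + m) ≤ (1 - θ) ^ m :=
      pow_le_pow_of_le_one (by linarith) (by linarith) (Nat.le_add_left m k)
    rw [surv]
    linarith
  have hV0 : 0 ≤ X.visits I x L x := by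
    rw [visits, Finset.sum_apply]
    refine Finset.sum_nonneg fun j _ => killed_pow_nonneg j (fun z => ?_) x
    by_cases h : z = x <;> simp [h]
  have hfm : ∀ z, (X.killed I ^ m) (X.visits I x L) z ≤
      X.visits I x L x * ((1 - θ) ^ m * (s * e z)) := by
    intro z
    have h1 := killed_pow_mono (X := X) (I := I) m (f := X.visits I x L)
      (g := X.visits I x L x • v) (fun z => (visits_le hx L z).trans
        (mul_le_mul_of_nonneg_left (pot_le_quasiEigen hI hx z) hV0)) z
    rw [map_smul, Pi.smul_apply, smul_eq_mul] at h1
    refine h1.trans (mul_le_mul_of_nonneg_left ?_ hV0)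
    refine (hgeom m z).trans (mul_le_mul_of_nonneg_left ?_ (pow_nonneg (by linarith) m))
    rw [hs]
    exact quasiEigen_le hI hx z
  have hQ := X.Q_pos x
  -- Self-adjointness moves the semigroup from `h` to the point mass at `x`; summed over the window,
  -- this becomes `visits`.
  have hw : X.Q x * ∑ k ∈ Finset.range L, (X.killed I ^ (k + m)) h x =
      ∑ z, X.Q z * (h z * (X.killed I ^ m) (X.visits I x L) z) := by
    have h1 : ∀ k, X.Q x * (X.killed I ^ (k + m)) h x =
        ∑ z, X.Q z * (h z * (X.killed I ^ (k + m)) (Pi.single x 1) z) := by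
      intro k
      rw [← sum_Q_killed_pow_comm (k + m) (fun z hz => single_eq_zero_of_mem hx hz) hhI,
        Finset.sum_eq_single x]
      · rw [Pi.single_eq_same, one_mul]
      · intro z _ hzx
        rw [Pi.single_eq_of_ne hzx]; ring
      · simp
    rw [Finset.mul_sum, Finset.sum_congr rfl fun k _ => h1 k, Finset.sum_comm]
    refine Finset.sum_congr rfl fun z _ => ?_
    rw [visits, map_sum, Finset.sum_apply, Finset.mul_sum, Finset.mul_sum]
    refine Finset.sum_congr rfl fun k _ => ?_
    rw [add_comm k m, pow_add]
    rfl
  have hw2 : X.Q x * ∑ k ∈ Finset.range L, (X.killed I ^ (k + m)) h x ≤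
      X.Q x * (X.visits I x L x * (1 - θ) ^ m * s * (X.potMass I x - X.potSq I x)) := by
    have h3 : X.Q x * (X.potMass I x - X.potSq I x) = ∑ z, X.Q z * (h z * e z) := by
      rw [potMass, potSq, ← sub_div, mul_div_cancel₀ _ hQ.ne', ← Finset.sum_sub_distrib]
      refine Finset.sum_congr rfl fun z _ => ?_
      by_cases hz : z ∈ I
      · rw [hhI z hz, harm_boundary hx hz]; ring
      · rw [hhz z hz, he]; ring
    have h4 : X.Q x * (X.visits I x L x * (1 - θ) ^ m * s * (X.potMass I x - X.potSq I x)) =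
        ∑ z, X.Q z * (h z * (X.visits I x L x * ((1 - θ) ^ m * (s * e z)))) := by
      rw [show X.Q x * (X.visits I x L x * (1 - θ) ^ m * s * (X.potMass I x - X.potSq I x)) =
        (X.visits I x L x * (1 - θ) ^ m * s) * (X.Q x * (X.potMass I x - X.potSq I x)) by ring,
        h3, Finset.mul_sum]
      exact Finset.sum_congr rfl fun z _ => by ring
    rw [hw, h4]
    exact Finset.sum_le_sum fun z _ => mul_le_mul_of_nonneg_left
      (mul_le_mul_of_nonneg_left (hfm z) (hh0 z)) (X.Q_nonneg z)
  have hw3 := le_of_mul_le_mul_left hw2 hQ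
  calc ∑ k ∈ Finset.range L, X.surv I (k + m) x
      ≤ ∑ k ∈ Finset.range L, ((1 - θ) ^ m + (X.killed I ^ (k + m)) h x) :=
        Finset.sum_le_sum fun k _ => hsplit k
    _ = L * (1 - θ) ^ m + ∑ k ∈ Finset.range L, (X.killed I ^ (k + m)) h x := by
        rw [Finset.sum_add_distrib]; simp
    _ ≤ _ := by linarith

end Window

end ExponentialLaw

end RevChain

/-! ### From geometric bounds to an exponential: real analysis. -/

/-- Two-sided geometric bounds on a survival function give an exponential law. -/
theorem abs_log_add_le_of_geometric_bounds {E D α : ℝ} {g : ℕ → ℝ} (hD : 0 ≤ D)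
    (hE : 8 * (D + 1) ≤ E) (hα1 : 1 ≤ α * E) (hα2 : α * (E - D) ≤ 1) (hg1 : ∀ n, g n ≤ 1)
    (hg : Antitone g) (hlow : ∀ n, (1 - α) ^ n ≤ (1 + α * D) * g n)
    (hup : ∀ m L : ℕ, ∑ k ∈ Finset.range L, g (k + m) ≤
      (1 - α / (1 + α * D)) ^ m * (L + (L + D) * (1 + α * D) * (α * D))) (n : ℕ) :
    0 < g n ∧ |Real.log (g n) + n / E| ≤ 4 * ((D + 1) / E) * (1 + n / E) := by
  have hE0 : 0 < E := by linarith
  have hα0 : 0 < α := by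
    by_contra! h
    nlinarith
  set δ := (D + 1) / E with hδ
  set t := (n : ℝ) / E with ht
  have hδE : δ * E = D + 1 := div_mul_cancel₀ _ hE0.ne'
  have htE : t * E = n := div_mul_cancel₀ _ hE0.ne'
  have hδ0 : 0 < δ := by positivity
  have hδ8 : δ ≤ 1 / 8 := by rw [hδ, div_le_iff₀ hE0]; linarith
  have ht0 : 0 ≤ t := by positivity
  have hαE : α * E ≤ 8 / 7 := by nlinarith
  have hαD : α * D ≤ 8 / 7 * δ := by
    have : α * D * E ≤ 8 / 7 * δ * E := by nlinarith
    exact le_of_mul_le_mul_right this hE0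
  have hαD0 : 0 ≤ α * D := by positivity
  have hα1' : α ≤ 1 / 7 := by nlinarith
  have hs0 : 0 < 1 + α * D := by linarith
  have hpow : 0 < (1 - α) ^ n := pow_pos (by linarith) n
  have hgpos : 0 < g n := by
    have := hpow.trans_le (hlow n)
    exact (mul_pos_iff_of_pos_left hs0).1 this
  refine ⟨hgpos, abs_le.2 ⟨?_, ?_⟩⟩
  · have h1 : n * Real.log (1 - α) ≤ α * D + Real.log (g n) := by
      have h2 := Real.log_le_log hpow (hlow n)
      rw [Real.log_pow, Real.log_mul hs0.ne' hgpos.ne'] at h2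
      have h3 := Real.log_le_sub_one_of_pos hs0
      linarith
    have h2 : -((1 + 2 * δ) / E) ≤ Real.log (1 - α) := by
      have h3 := Real.one_sub_inv_le_log_of_pos (show 0 < 1 - α by linarith)
      have h4 : 1 - (1 - α)⁻¹ = -(α / (1 - α)) := by
        have : 1 - α ≠ 0 := by linarith
        field_simp
        ring
      have h5 : α / (1 - α) ≤ (1 + 2 * δ) / E := by
        rw [div_le_div_iff₀ (by linarith) hE0]
        have h6 : α * (E * (1 - δ)) ≤ 1 - α := by nlinarith
        have h7 : 0 ≤ α * E * (δ * (1 - 2 * δ)) := by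
          have : 0 ≤ 1 - 2 * δ := by linarith
          positivity
        nlinarith
      linarith
    have h3 : -(t * (1 + 2 * δ)) ≤ n * Real.log (1 - α) := by
      have h4 := mul_le_mul_of_nonneg_left h2 (Nat.cast_nonneg (α := ℝ) n)
      calc -(t * (1 + 2 * δ)) = n * -((1 + 2 * δ) / E) := by rw [ht]; ring
        _ ≤ _ := h4
    nlinarith
  -- A positive window length with `D ≤ L ≤ D + 1`: long enough that `L + D ≤ 2 L`, short enough
  -- that losing `L` steps costs at most `δ` in units of `E`.
  · set L := ⌊D⌋₊ + 1 with hL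
    have hL1 : D ≤ L := by rw [hL]; push_cast; exact (Nat.lt_floor_add_one D).le
    have hL2 : (L : ℝ) ≤ D + 1 := by
      rw [hL]; push_cast; linarith [Nat.floor_le hD]
    have hL0 : (0 : ℝ) < L := by rw [hL]; positivity
    -- Before time `L` no window fits, but then `t ≤ δ` and `g n ≤ 1` suffices.
    rcases Nat.lt_or_ge n L with hn | hn
    · have h1 : Real.log (g n) ≤ 0 := Real.log_nonpos hgpos.le (hg1 n)
      have h2 : t ≤ δ := by
        rw [ht, hδ]
        gcongr
        exact (Nat.cast_le.2 hn.le).trans hL2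
      nlinarith
    · obtain ⟨m, rfl⟩ : ∃ m, n = L + m := ⟨n - L, by omega⟩
      set θ := α / (1 + α * D) with hθ
      have hθ1 : θ ≤ 1 / 7 := by
        rw [hθ, div_le_iff₀ hs0]; nlinarith
      have hwin : L * g (L + m) ≤ ∑ k ∈ Finset.range L, g (k + m) := by
        have : ∑ k ∈ Finset.range L, g (L + m) ≤ ∑ k ∈ Finset.range L, g (k + m) :=
          Finset.sum_le_sum fun k hk => hg (by have := Finset.mem_range.1 hk; omega)
        simpa using this
      have hw2 : g (L + m) ≤ (1 - θ) ^ m * (1 + 2 * (1 + α * D) * (α * D)) := by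
        refine le_of_mul_le_mul_left ?_ hL0
        refine hwin.trans ((hup m L).trans ?_)
        rw [mul_left_comm (L : ℝ)]
        refine mul_le_mul_of_nonneg_left ?_ (pow_nonneg (by linarith) m)
        have : 0 ≤ (L - D) * ((1 + α * D) * (α * D)) :=
          mul_nonneg (by linarith) (by positivity)
        nlinarith
      have hc0 : 0 < 1 + 2 * (1 + α * D) * (α * D) := by positivity
      have hlog : Real.log (g (L + m)) ≤ m * -θ + 2 * (1 + α * D) * (α * D) := by
        have h1 := Real.log_le_log hgpos hw2
        rw [Real.log_mul (pow_pos (by linarith) m).ne' hc0.ne', Real.log_pow] at h1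
        have h2 := Real.log_le_sub_one_of_pos (show 0 < 1 - θ by linarith)
        have h3 := Real.log_le_sub_one_of_pos hc0
        have h4 := mul_le_mul_of_nonneg_left h2 (Nat.cast_nonneg (α := ℝ) m)
        linarith
      have h5 : 2 * (1 + α * D) * (α * D) ≤ 3 * δ := by nlinarith
      have h6 : 1 / (E + D) ≤ θ := by
        rw [hθ, div_le_div_iff₀ (by linarith) hs0]
        nlinarith
      have h7 : (1 - δ) * t - δ ≤ m * θ := by
        have h8 := mul_le_mul_of_nonneg_left h6 (Nat.cast_nonneg (α := ℝ) m)
        refine le_trans ?_ h8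
        rw [mul_one_div, le_div_iff₀ (by linarith)]
        have h9 : t * E = L + m := by rw [htE]; push_cast; ring
        have h10 : δ * t * E = t * (D + 1) := by rw [← hδE]; ring
        have h11 : 0 ≤ t * δ * D := by positivity
        have h12 : 0 ≤ δ * D := by positivity
        linarith
      have h8 : 0 ≤ δ * t := by positivity
      linarith

/-- Write `log q = -t + η (1 + t)`. The term `η` goes into the prefactor and `η t` into the rate;
the factor two comes from `|exp η - 1| ≤ 2 |η|` for `|η| ≤ 1`. -/
theorem exists_exponential_form {q t δ : ℝ} (hq : 0 < q) (ht : 0 ≤ t) (hδ : δ ≤ 1)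
    (h : |Real.log q + t| ≤ δ * (1 + t)) :
    ∃ A B : ℝ, |A - 1| ≤ 2 * δ ∧ |B - 1| ≤ 2 * δ ∧ q = A * Real.exp (-t * B) := by
  set η := (Real.log q + t) / (1 + t) with hη
  have h1 : |η| ≤ δ := by
    rw [hη, abs_div, abs_of_pos (show 0 < 1 + t by linarith), div_le_iff₀ (by linarith)]
    exact h
  have hδ0 : 0 ≤ δ := (abs_nonneg _).trans h1
  refine ⟨Real.exp η, 1 - η, ?_, ?_, ?_⟩
  · exact (Real.abs_exp_sub_one_le (h1.trans hδ)).trans (by linarith)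
  · rw [sub_sub_cancel_left, abs_neg]
    linarith
  · rw [← Real.exp_add]
    have : η + -t * (1 - η) = Real.log q := by
      have : η * (1 + t) = Real.log q + t := div_mul_cancel₀ _ (by linarith)
      linarith
    rw [this, Real.exp_log hq]

namespace RevChain

variable {Γ : Type u} [Fintype Γ] {X : RevChain Γ} {I : Set Γ} {x : Γ}

/-- The exponential law of the hitting time of `I` started in `x`: the error is governed by the
trace of the Green function of the chain killed on `I ∪ {x}`. -/
theorem abs_log_surv_add_le (hI : I.Nonempty) (hx : x ∉ I) {u : Γ → ℝ} (hu : ∀ z ∈ I, u z = 0)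
    (hlap : ∀ z ∉ I, X.lap u z = 1) (hE : 8 * (X.greenTrace (insert x I) + 1) ≤ u x) (n : ℕ) :
    0 < X.surv I n x ∧ |Real.log (X.surv I n x) + n / u x| ≤
      4 * ((X.greenTrace (insert x I) + 1) / u x) * (1 + n / u x) := by
  have hp := esc_pos (X := X) hI hx
  have hB1 := one_le_potSq (X := X) (I := I) (x := x)
  have hB0 : 0 < X.potSq I x := zero_lt_one.trans_le hB1
  have hm := esc_mul_mean (X := X) hx hu hlap
  have hγ := potMass_sub_potSq_le (X := X) hx
  have hγ0 := potSq_le_potMass (X := X) (I := I) (x := x)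
  have hD := greenTrace_nonneg (X := X) (Set.insert_nonempty x I)
  set α := X.esc x I / X.potSq I x with hα
  have hαB : α * X.potSq I x = X.esc x I := div_mul_cancel₀ _ hB0.ne'
  have hα0 : 0 < α := div_pos hp hB0
  refine abs_log_add_le_of_geometric_bounds (α := α) (g := fun n => X.surv I n x) hD hE ?_ ?_
    (fun n => surv_le_one n x) (surv_antitone x) (surv_lower hI hx) (fun m L => ?_) n
  -- By `esc_mul_mean`, `α * u x` is `potMass / potSq`. It is at least one since `potSq ≤ potMass`;
  -- the next goal is `potMass_sub_potSq_le` divided by `potSq`.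
  · rw [hα, div_mul_eq_mul_div, le_div_iff₀ hB0]
    linarith
  · rw [hα, div_mul_eq_mul_div, div_le_iff₀ hB0]
    linarith
  · have hw := sum_surv_window_le (X := X) hI hx rfl rfl m L
    rw [← hα] at hw
    refine hw.trans (mul_le_mul_of_nonneg_left ?_ (pow_nonneg ?_ m))
    · have hV := potSq_mul_visits_le (X := X) hI hx L
      have hVγ : X.visits I x L x * (X.potMass I x - X.potSq I x) ≤
          (L + X.greenTrace (insert x I)) * (α * X.greenTrace (insert x I)) := by
        refine le_of_mul_le_mul_left ?_ hB0
        calc X.potSq I x * (X.visits I x L x * (X.potMass I x - X.potSq I x))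
            = (X.potSq I x * X.visits I x L x) * (X.potMass I x - X.potSq I x) := by ring
          _ ≤ (L + X.greenTrace (insert x I)) * (X.potMass I x - X.potSq I x) :=
              mul_le_mul_of_nonneg_right hV (by linarith)
          _ ≤ (L + X.greenTrace (insert x I)) * (X.esc x I * X.greenTrace (insert x I)) :=
              mul_le_mul_of_nonneg_left hγ (by positivity)
          _ = _ := by rw [← hαB]; ring
      have hs0 : 0 ≤ 1 + α * X.greenTrace (insert x I) := by positivity
      have := mul_le_mul_of_nonneg_left hVγ hs0
      linarith
    · rw [sub_nonneg, div_le_one (by positivity)]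
      have : α ≤ 1 := rate_le_one
      linarith [mul_nonneg hα0.le hD]

end RevChain

/-! ### Probabilities of hitting events as potential-theoretic quantities. -/

theorem toENNReal_eq_tsum (m : ℕ∞) :
    (m : ℝ≥0∞) = ∑' n : ℕ, {k : ℕ | (k : ℕ∞) < m}.indicator (fun _ => (1 : ℝ≥0∞)) n := by
  cases m with
  | top => simp
  | coe k =>
    rw [tsum_eq_sum (s := Finset.range k)]
    · rw [Finset.sum_congr rfl fun n hn => Set.indicator_of_mem
        (show n ∈ {j : ℕ | (j : ℕ∞) < (k : ℕ∞)} from by simpa using hn) _]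
      simp
    · intro n hn
      exact Set.indicator_of_notMem (by simpa using hn) _

namespace RevChain

variable {Γ : Type u} [Fintype Γ] {X : RevChain Γ} [MeasurableSpace Γ] [DiscreteMeasurableSpace Γ]

/-- Events that agree on the trajectories from `y` have the same probability under `X.law y`. -/
theorem law_real_congr (y : Γ) {V W : Set (ℕ → Γ)} (h : ∀ ω, ω 0 = y → (ω ∈ V ↔ ω ∈ W)) :
    (X.law y).real V = (X.law y).real W := by
  refine measureReal_congr ?_
  filter_upwards [X.law_start y] with ω hω
  exact propext (h ω hω)

open Classical in
/-- An event that holds when the first visited point of `S` lies in `A`, fails when it lies in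
`S \ A`, and is invariant under the shift before `S` is visited. -/
theorem law_real_eq_harm {A S : Set Γ} (hS : S.Nonempty) (hAS : A ⊆ S) {V : Set (ℕ → Γ)}
    (hV : MeasurableSet V) (h1 : ∀ x ω, ω 0 ∈ A → consPath x ω ∈ V)
    (h2 : ∀ x ω, ω 0 ∈ S → ω 0 ∉ A → consPath x ω ∉ V)
    (h3 : ∀ x ω, ω 0 ∉ S → (consPath x ω ∈ V ↔ ω ∈ V)) (x : Γ) :
    (X.law x).real V = X.P (X.harm A S) x := by
  -- `G y` is the probability of the event given that the chain is at `y` at time one. Hitting times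
  -- ignore the starting point, so the answer is one transition step applied to the harmonic
  -- function rather than the function itself.
  set G : Γ → ℝ := fun y => if y ∈ A then 1 else if y ∈ S then 0 else (X.law y).real V with hG
  have hF : ∀ x, (X.law x).real V = X.P G x := by
    intro x
    rw [law_real_eq_sum X x hV, P_apply]
    refine Finset.sum_congr rfl fun y _ => ?_
    congr 1
    simp only [hG]
    split_ifs with hyA hyS
    · rw [law_real_congr y (V := consPath x ⁻¹' V) (W := Set.univ) fun ω hω =>
        ⟨fun _ => trivial, fun _ => h1 x ω (hω ▸ hyA)⟩]
      exact probReal_univ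
    · rw [law_real_congr y (V := consPath x ⁻¹' V) (W := ∅) fun ω hω =>
        ⟨fun h => (h2 x ω (hω ▸ hyS) (hω ▸ hyA) h).elim, fun h => h.elim⟩]
      exact measureReal_empty
    · exact law_real_congr y fun ω hω => h3 x ω (hω ▸ hyS)
  -- Uniqueness for the Dirichlet problem also disposes of the trajectories that never visit `S`, on
  -- which `V` is unspecified apart from shift invariance.
  have hGh : G = X.harm A S := by
    refine harm_unique hS hAS (fun z hz => if_pos hz) (fun z hz hzA => ?_) fun z hz => ?_
    · simp only [hG]; rw [if_neg hzA, if_pos hz]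
    · have : G z = (X.law z).real V := by
        simp only [hG]; rw [if_neg fun h => hz (hAS h), if_neg hz]
      rw [lap_apply, this, hF z, sub_self]
  rw [hF x, hGh]

theorem law_hit_le_hit {x : Γ} {I : Set Γ} (hx : x ∉ I) :
    (X.law x).real {ω | hit I ω ≤ hit {x} ω} = X.esc x I := by
  rw [esc_eq_harm hx]
  refine law_real_eq_harm (Set.insert_nonempty x I) (Set.subset_insert x I)
    (measurableSet_hit_rel I {x} (· ≤ ·)) (fun y ω hω => ?_) (fun y ω hS hA => ?_)
    (fun y ω hS => ?_) x
  · rw [Set.mem_ofPred_eq, hit_consPath_of_mem y hω]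
    exact one_le_hit _ _
  · have hωx : ω 0 ∈ ({x} : Set Γ) := hS.resolve_right hA
    rw [Set.mem_ofPred_eq, hit_consPath_of_mem y hωx, hit_consPath_of_notMem y hA]
    intro h
    have := (add_le_add_left (one_le_hit I ω) 1).trans h
    exact absurd this (by decide)
  · have h1 : ω 0 ∉ I := fun h => hS (Set.mem_insert_of_mem x h)
    have h2 : ω 0 ∉ ({x} : Set Γ) := fun h => hS (Set.mem_insert_iff.2 (Or.inl h))
    rw [Set.mem_ofPred_eq, hit_consPath_of_notMem y h1, hit_consPath_of_notMem y h2,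
      Set.mem_ofPred_eq]
    exact ENat.add_le_add_iff_right ENat.one_ne_top

theorem law_hit_lt_hit {x y : Γ} (hxy : x ≠ y) :
    (X.law x).real {ω | hit {y} ω < hit {x} ω} = X.esc x {y} := by
  rw [esc_eq_harm (show x ∉ ({y} : Set Γ) from hxy)]
  refine law_real_eq_harm (Set.insert_nonempty x {y}) (Set.subset_insert x {y})
    (measurableSet_hit_rel {y} {x} (· < ·)) (fun z ω hω => ?_) (fun z ω hS hA => ?_)
    (fun z ω hS => ?_) x
  · have h2 : ω 0 ∉ ({x} : Set Γ) := fun h =>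
      hxy ((Set.mem_singleton_iff.1 h).symm.trans (Set.mem_singleton_iff.1 hω))
    rw [Set.mem_ofPred_eq, hit_consPath_of_mem z hω, hit_consPath_of_notMem z h2]
    exact lt_of_lt_of_le (by decide) (add_le_add_left (one_le_hit {x} ω) 1)
  · have hωx : ω 0 ∈ ({x} : Set Γ) := hS.resolve_right hA
    rw [Set.mem_ofPred_eq, hit_consPath_of_mem z hωx, not_lt]
    exact one_le_hit _ _
  · have h1 : ω 0 ∉ ({y} : Set Γ) := fun h => hS (Set.mem_insert_of_mem x h)
    have h2 : ω 0 ∉ ({x} : Set Γ) := fun h => hS (Set.mem_insert_iff.2 (Or.inl h))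
    rw [Set.mem_ofPred_eq, hit_consPath_of_notMem z h1, hit_consPath_of_notMem z h2,
      Set.mem_ofPred_eq]
    exact ENat.add_lt_add_iff_right ENat.one_ne_top

theorem law_hit_eq_hit {y : Γ} {M : Set Γ} (hy : y ∈ M) (z : Γ) :
    (X.law z).real {ω | hit {y} ω = hit M ω} = X.P (X.harm {y} M) z := by
  have hyM : ({y} : Set Γ) ⊆ M := Set.singleton_subset_iff.2 hy
  refine law_real_eq_harm ⟨y, hy⟩ hyM (measurableSet_hit_rel {y} M (· = ·)) (fun z ω hω => ?_)
    (fun z ω hS hA => ?_) (fun z ω hS => ?_) z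
  · rw [Set.mem_ofPred_eq, hit_consPath_of_mem z hω, hit_consPath_of_mem z (hyM hω)]
  · rw [Set.mem_ofPred_eq, hit_consPath_of_notMem z hA, hit_consPath_of_mem z hS]
    intro h
    have := (add_le_add_left (one_le_hit {y} ω) 1).trans h.le
    exact absurd this (by decide)
  · rw [Set.mem_ofPred_eq, hit_consPath_of_notMem z fun h => hS (hyM h),
      hit_consPath_of_notMem z hS, Set.mem_ofPred_eq]
    exact (ENat.add_left_injective_of_ne_top ENat.one_ne_top).eq_iff

theorem T_eq_esc_inv {x : Γ} {I : Set Γ} (hx : x ∉ I) : X.T x I = (X.esc x I)⁻¹ := by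
  rw [T, law_hit_le_hit hx]

open Classical in
theorem law_lt_hit {I : Set Γ} (n : ℕ) {x : Γ} (hx : x ∉ I) :
    (X.law x).real {ω | (n : ℕ∞) < hit I ω} = X.surv I n x := by
  induction n generalizing x with
  | zero =>
    rw [surv_zero hx]
    have : {ω : ℕ → Γ | ((0 : ℕ) : ℕ∞) < hit I ω} = Set.univ := by
      refine Set.eq_univ_of_forall fun ω => ?_
      exact lt_of_lt_of_le (by decide) (one_le_hit I ω)
    rw [this, probReal_univ]
  | succ n ih =>
    have hm : MeasurableSet {ω : ℕ → Γ | ((n + 1 : ℕ) : ℕ∞) < hit I ω} :=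
      measurableSet_hit_rel I I fun a _ => ((n + 1 : ℕ) : ℕ∞) < a
    rw [surv_succ n hx, P_apply, law_real_eq_sum X x hm]
    refine Finset.sum_congr rfl fun y _ => ?_
    congr 1
    by_cases hy : y ∈ I
    · rw [surv_of_mem n hy, law_real_congr y (W := ∅) fun ω hω => ?_, measureReal_empty]
      rw [Set.mem_preimage, Set.mem_ofPred_eq, hit_consPath_of_mem x (hω ▸ hy)]
      simp
    · rw [← ih hy]
      refine law_real_congr y fun ω hω => ?_
      rw [Set.mem_preimage, Set.mem_ofPred_eq, hit_consPath_of_notMem x (hω ▸ hy),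
        Set.mem_ofPred_eq]
      push_cast
      exact ENat.add_lt_add_iff_right ENat.one_ne_top

theorem meanHit_eq {I : Set Γ} (hI : I.Nonempty) {u : Γ → ℝ} (hu : ∀ z ∈ I, u z = 0)
    (hlap : ∀ z ∉ I, X.lap u z = 1) {x : Γ} (hx : x ∉ I) :
    X.meanHit x I = ENNReal.ofReal (u x) := by
  have hm : ∀ n : ℕ, MeasurableSet {ω : ℕ → Γ | (n : ℕ∞) < hit I ω} := fun n =>
    measurableSet_hit_rel I I fun a _ => (n : ℕ∞) < a
  have h1 : ∀ ω : ℕ → Γ, (hit I ω : ℝ≥0∞) =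
      ∑' n : ℕ, {ω : ℕ → Γ | (n : ℕ∞) < hit I ω}.indicator (fun _ => (1 : ℝ≥0∞)) ω := fun ω =>
    toENNReal_eq_tsum (hit I ω)
  rw [meanHit, lintegral_congr h1, lintegral_tsum fun n =>
    (measurable_const.indicator (hm n)).aemeasurable]
  have hsum := hasSum_surv (X := X) hI hu hlap x
  rw [← hsum.tsum_eq, ENNReal.ofReal_tsum_of_nonneg (fun n => surv_nonneg n x) hsum.summable]
  refine tsum_congr fun n => ?_
  rw [lintegral_indicator_const (hm n), one_mul, ← law_lt_hit n hx, ofReal_measureReal]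

end RevChain

/-! ### Sums of separated numbers. -/

/-- A sum of positive reals that are pairwise separated by a factor two is at most twice its
largest term. -/
theorem Finset.sum_le_two_mul_of_separated {ι : Type*} [DecidableEq ι] (s : Finset ι) {T : ι → ℝ}
    {ϵ B : ℝ} (hϵ : ϵ ≤ 1 / 2) (hB0 : 0 ≤ B) (hT : ∀ i ∈ s, 0 < T i) (hB : ∀ i ∈ s, T i ≤ B)
    (hsep : ∀ i ∈ s, ∀ j ∈ s, i ≠ j → T i ≤ ϵ * T j ∨ T j ≤ ϵ * T i) :
    ∑ i ∈ s, T i ≤ 2 * B := by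
  induction hn : s.card generalizing s B with
  | zero =>
    rw [Finset.card_eq_zero.1 hn, Finset.sum_empty]
    linarith
  | succ n ih =>
    obtain ⟨m, hm, hmax⟩ := s.exists_max_image T (Finset.card_pos.1 (by omega))
    rw [← Finset.add_sum_erase s T hm]
    -- Separation from the largest term puts all others below `B / 2`, so the induction is run with
    -- the bound halved.
    have h1 : ∑ i ∈ s.erase m, T i ≤ 2 * (B / 2) := by
      refine ih (s.erase m) (by linarith) (fun i hi => hT i (Finset.mem_of_mem_erase hi))
        (fun i hi => ?_) (fun i hi j hj => hsep i (Finset.mem_of_mem_erase hi) j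
          (Finset.mem_of_mem_erase hj)) (by rw [Finset.card_erase_of_mem hm, hn]; rfl)
      have his := Finset.mem_of_mem_erase hi
      have hmT := hT m hm
      have hiT := hT i his
      have hle := hmax i his
      have hmB := hB m hm
      rcases hsep i his m hm (Finset.ne_of_mem_erase hi) with h | h
      · nlinarith
      · nlinarith
    linarith [hB m hm]

/-! ### Conductances between metastable points and the Green trace. -/

namespace RevChain

section Metastable

variable {Γ : Type u} [Fintype Γ] {X : RevChain Γ} {M J : Set Γ} {x y z m : Γ}

theorem harm_singleton_nonneg (hy : y ∈ M) (z : Γ) : 0 ≤ X.harm {y} M z :=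
  harm_nonneg ⟨y, hy⟩ (Set.singleton_subset_iff.2 hy) z

theorem harm_singleton_self (hy : y ∈ M) : X.harm {y} M y = 1 :=
  harm_of_mem (Set.singleton_subset_iff.2 hy) rfl

theorem harm_singleton_of_ne (hy : y ∈ M) (hz : z ∈ M) (hzy : z ≠ y) : X.harm {y} M z = 0 :=
  harm_of_notMem (Set.singleton_subset_iff.2 hy) hz hzy

theorem lap_harm_singleton (hy : y ∈ M) (hz : z ∉ M) : X.lap (X.harm {y} M) z = 0 :=
  lap_harm ⟨y, hy⟩ (Set.singleton_subset_iff.2 hy) hz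

/-- The conductance between `z` and `y` in the trace of the chain on `M ∪ {z}`. -/
theorem conductance_eq (hz : z ∉ M) (hy : y ∈ M) :
    X.Q y * X.P (X.harm {z} (insert z M)) y = X.Q z * (X.harm {y} M z * X.esc z M) := by
  classical
  have hyz : y ≠ z := fun h => hz (h ▸ hy)
  have h := X.sum_Q_lap_comm (X.harm {y} M) (X.harm {z} (insert z M))
  have hR : ∑ w, X.Q w * (X.harm {z} (insert z M) w * X.lap (X.harm {y} M) w) = 0 := by
    refine Finset.sum_eq_zero fun w _ => ?_
    by_cases hw : w ∈ M
    · rw [harm_boundary hz hw]; ring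
    · rw [lap_harm_singleton hy hw]; ring
  rw [hR, ← Finset.sum_subset (Finset.subset_univ {y, z}), Finset.sum_pair hyz,
    harm_singleton_self hy, lap_apply _ _ y, harm_boundary hz hy, ← esc] at h
  · linarith
  · intro w _ hw
    simp only [Finset.mem_insert, Finset.mem_singleton, not_or] at hw
    by_cases hwM : w ∈ M
    · rw [harm_singleton_of_ne hy hwM hw.1]; ring
    · rw [lap_pot (by simp [hwM, hw.2])]; ring

theorem conductance_le (hz : z ∉ M) (hy : y ∈ M) :
    X.Q z * (X.harm {y} M z * X.esc z M) ≤ X.Q y := by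
  rw [← conductance_eq hz hy]
  have : X.P (X.harm {z} (insert z M)) y ≤ 1 :=
    (X.P_mono (pot_le_one z M) y).trans (X.P_const 1 y).le
  exact mul_le_of_le_one_right (X.Q_nonneg y) this

/-- One way to go from `y` to `m` before returning is to enter `M ∪ {z}` at `z` and to go on from
`z` to `m` before `y`; the left side is this contribution to the effective conductance. -/
theorem pot_mul_conductance_le (hz : z ∉ M) (hy : y ∈ M) (hm : m ∈ M) (hym : y ≠ m) :
    X.harm {m} (insert m {y}) z * (X.Q z * (X.harm {y} M z * X.esc z M)) ≤
      X.Q y * X.esc y {m} := by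
  rw [← conductance_eq hz hy, esc_eq_harm (show y ∉ ({m} : Set Γ) from hym),
    show (insert y {m} : Set Γ) = insert m {y} from Set.pair_comm y m]
  have hsub : (insert m {y} : Set Γ) ⊆ M := Set.insert_subset hm (Set.singleton_subset_iff.2 hy)
  have h := X.P_mono (f := X.harm {m} (insert m {y}) z • X.harm {z} (insert z M))
    (g := X.harm {m} (insert m {y})) (fun w => by
      have := pot_mul_le (X := X) (k := X.harm {m} (insert m {y})) hz (pot_nonneg m {y})
        (fun v hv => (lap_pot fun h => hv (hsub h)).ge) w
      rw [Pi.smul_apply, smul_eq_mul]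
      linarith) y
  rw [map_smul, Pi.smul_apply, smul_eq_mul] at h
  calc _ = X.Q y * (X.harm {m} (insert m {y}) z * X.P (X.harm {z} (insert z M)) y) := by ring
    _ ≤ _ := mul_le_mul_of_nonneg_left h (X.Q_nonneg y)

theorem pot_add_pot (hym : y ≠ m) (z : Γ) :
    X.harm {m} (insert m {y}) z + X.harm {y} (insert y {m}) z = 1 := by
  have h := harm_sdiff (X := X) (Set.insert_nonempty m {y}) (singleton_subset_insert m {y}) z
  rw [Set.insert_sdiff_of_mem _ (Set.mem_singleton m),
    Set.sdiff_singleton_eq_self (show m ∉ ({y} : Set Γ) from hym.symm)] at h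
  rw [show (insert y {m} : Set Γ) = insert m {y} from Set.pair_comm y m, h]
  ring

/-- The conductance from `z` to the less likely of two points is at most twice the effective
conductance between these points. -/
theorem conductance_le_two_mul (hz : z ∉ M) (hy : y ∈ M) (hm : m ∈ M) (hym : y ≠ m)
    (hle : X.harm {y} M z ≤ X.harm {m} M z) :
    X.Q z * (X.harm {y} M z * X.esc z M) ≤ 2 * (X.Q y * X.esc y {m}) := by
  have h1 := pot_mul_conductance_le (X := X) hz hy hm hym
  have h2 := pot_mul_conductance_le (X := X) hz hm hy hym.symm
  -- The two bounds now have the same right side. They carry the weights of `m` and of `y` as seen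
  -- from `z`, which add up to one, so their sum bounds the smaller conductance.
  rw [← esc_symm hym] at h2
  have hE : 0 ≤ X.esc z M := (esc_pos ⟨y, hy⟩ hz).le
  have h3 : X.harm {y} (insert y {m}) z * (X.Q z * (X.harm {y} M z * X.esc z M)) ≤
      X.harm {y} (insert y {m}) z * (X.Q z * (X.harm {m} M z * X.esc z M)) :=
    mul_le_mul_of_nonneg_left (mul_le_mul_of_nonneg_left
      (mul_le_mul_of_nonneg_right hle hE) (X.Q_nonneg z)) (pot_nonneg y {m} z)
  have h4 := pot_add_pot (X := X) hym z
  calc X.Q z * (X.harm {y} M z * X.esc z M)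
      = (X.harm {m} (insert m {y}) z + X.harm {y} (insert y {m}) z) *
        (X.Q z * (X.harm {y} M z * X.esc z M)) := by rw [h4, one_mul]
    _ ≤ _ := by linarith

theorem sum_harm_singleton (M : Finset Γ) (hM : M.Nonempty) (z : Γ) :
    ∑ y ∈ M, X.harm {y} (M : Set Γ) z = 1 := by
  have hMs : (M : Set Γ).Nonempty := hM
  have h1 : (∑ y ∈ M, X.harm {y} (M : Set Γ)) = X.harm (M : Set Γ) M := by
    refine harm_unique hMs subset_rfl (fun w hw => ?_) (fun w hw h => (h hw).elim) fun w hw => ?_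
    · rw [Finset.sum_apply, Finset.sum_eq_single_of_mem w hw fun y hy hyw =>
        harm_singleton_of_ne hy hw hyw.symm, harm_singleton_self hw]
    · rw [map_sum, Finset.sum_apply]
      exact Finset.sum_eq_zero fun y hy => lap_harm_singleton hy hw
  have h2 : (fun _ => 1) = X.harm (M : Set Γ) M :=
    harm_unique hMs subset_rfl (fun _ _ => rfl) (fun w hw h => (h hw).elim)
      fun w _ => lap_const X 1 w
  have := congrFun (h1.trans h2.symm) z
  rwa [Finset.sum_apply] at this

theorem sum_P_harm_singleton (M : Finset Γ) (hM : M.Nonempty) (z : Γ) :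
    ∑ y ∈ M, X.P (X.harm {y} (M : Set Γ)) z = 1 := by
  have h : (∑ y ∈ M, X.harm {y} (M : Set Γ)) = fun _ => 1 := by
    ext w
    rw [Finset.sum_apply, sum_harm_singleton M hM]
  rw [← Finset.sum_apply, ← map_sum, h, P_const]

theorem P_harm_singleton_le_esc (hx : x ∈ M) (hy : y ∈ M) (hxy : x ≠ y) :
    X.P (X.harm {y} M) x ≤ X.esc x {y} := by
  rw [esc_eq_harm (show x ∉ ({y} : Set Γ) from hxy)]
  have hsub : (insert x {y} : Set Γ) ⊆ M := Set.insert_subset hx (Set.singleton_subset_iff.2 hy)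
  have hne := Set.insert_nonempty x ({y} : Set Γ)
  have hss := Set.subset_insert x ({y} : Set Γ)
  refine X.P_mono (X.comparison ⟨y, hy⟩ (fun w hw => ?_) fun w hw => ?_) x
  · rw [lap_harm_singleton hy hw, lap_harm hne hss fun h => hw (hsub h)]
  · by_cases hwy : w = y
    · rw [hwy, harm_singleton_self hy, harm_of_mem hss rfl]
    · rw [harm_singleton_of_ne hy hw hwy]
      exact harm_nonneg hne hss w

theorem esc_le_sum (J : Finset Γ) (hx : x ∉ J) :
    X.esc x (J : Set Γ) ≤ ∑ y ∈ J, X.esc x {y} := by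
  have hxJ : x ∉ (J : Set Γ) := hx
  rw [esc_eq_harm hxJ]
  have hne := Set.insert_nonempty x (J : Set Γ)
  have hxy : ∀ y ∈ J, x ∉ ({y} : Set Γ) := fun y hy h => hx (Set.mem_singleton_iff.1 h ▸ hy)
  have hsum : ∑ y ∈ J, X.esc x {y} = X.P (∑ y ∈ J, X.harm {y} (insert x {y})) x := by
    rw [map_sum, Finset.sum_apply]
    exact Finset.sum_congr rfl fun y hy => esc_eq_harm (hxy y hy)
  have h0 : ∀ y w, 0 ≤ X.harm {y} (insert x {y}) w := fun y w =>
    harm_nonneg (Set.insert_nonempty x {y}) (Set.subset_insert x {y}) w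
  rw [hsum]
  refine X.P_mono (X.comparison hne (fun w hw => ?_) fun w hw => ?_) x
  · rw [lap_harm hne (Set.subset_insert x _) hw, map_sum, Finset.sum_apply,
      Finset.sum_eq_zero fun y hy => ?_]
    refine lap_harm (Set.insert_nonempty x {y}) (Set.subset_insert x {y}) fun h => hw ?_
    rcases h with h | h
    · exact Or.inl h
    · exact Or.inr (Set.mem_singleton_iff.1 h ▸ hy)
  · rw [Finset.sum_apply]
    rcases hw with rfl | hw
    · rw [harm_of_notMem (Set.subset_insert w _) (Set.mem_insert w _) hxJ]
      exact Finset.sum_nonneg fun y _ => h0 y w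
    · rw [harm_of_mem (Set.subset_insert x _) hw]
      have h1 : X.harm {w} (insert x {w}) w = 1 := harm_of_mem (Set.subset_insert x {w}) rfl
      rw [← h1]
      exact Finset.single_le_sum (f := fun y => X.harm {y} (insert x {y}) w)
        (fun y _ => h0 y w) hw

/-- Symmetry of the Green function with respect to `Q`, with denominators cleared. -/
theorem pot_symm (hx : x ∉ J) (hy : y ∉ J) :
    X.Q x * (X.harm {y} (insert y J) x * X.esc x J) =
      X.Q y * (X.harm {x} (insert x J) y * X.esc y J) := by
  have h := X.sum_Q_lap_comm (X.harm {y} (insert y J)) (X.harm {x} (insert x J))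
  rwa [Finset.sum_eq_single x, Finset.sum_eq_single y] at h
  · intro w _ hwy
    by_cases hw : w ∈ J
    · rw [harm_boundary hx hw]; ring
    · rw [lap_pot (by simp [hwy, hw])]; ring
  · simp
  · intro w _ hwx
    by_cases hw : w ∈ J
    · rw [harm_boundary hy hw]; ring
    · rw [lap_pot (by simp [hwx, hw])]; ring
  · simp

open Classical in
/-- The Green function of the chain killed on `J`, decomposed at the first visit to `M`. -/
theorem esc_inv_le (M : Finset Γ) {J : Set Γ} (hJ : J.Nonempty) (hJM : J ⊆ M) (hz : z ∉ M) :
    (X.esc z J)⁻¹ ≤ (X.esc z (M : Set Γ))⁻¹ + ∑ m ∈ M with m ∉ J,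
      X.harm {m} (M : Set Γ) z * (X.Q z / X.Q m) * (X.esc m J)⁻¹ := by
  have hzM : z ∉ (M : Set Γ) := hz
  have hzJ : z ∉ J := fun h => hz (hJM h)
  have hMs : (M : Set Γ).Nonempty := hJ.mono hJM
  have hez := esc_pos (X := X) hJ hzJ
  have hezM := esc_pos (X := X) hMs hzM
  -- The Green column at `z` for killing on `J`. It is compared with the column for killing on all
  -- of `M` plus the harmonic extension of its values on `M \ J`.
  set G : Γ → ℝ := (X.esc z J)⁻¹ • X.harm {z} (insert z J) with hG
  have hG0 : ∀ w, 0 ≤ G w := fun w => mul_nonneg (inv_nonneg.2 hez.le) (pot_nonneg z J w)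
  have key := X.comparison hMs (f := G)
    (g := (X.esc z (M : Set Γ))⁻¹ • X.harm {z} (insert z (M : Set Γ)) +
      ∑ m ∈ M with m ∉ J, G m • X.harm {m} (M : Set Γ)) (fun w hw => ?_) (fun w hw => ?_) z
  · simp only [Pi.add_apply, Pi.smul_apply, smul_eq_mul, Finset.sum_apply, harm_self, mul_one] at key
    have hGz : G z = (X.esc z J)⁻¹ := by simp [hG, harm_self]
    rw [hGz] at key
    refine key.trans (add_le_add_right (Finset.sum_le_sum fun m hm => ?_) _)
    obtain ⟨hmM, hmJ⟩ := Finset.mem_filter.1 hm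
    have hem := esc_pos (X := X) hJ hmJ
    have hs := pot_symm (X := X) hmJ hzJ
    -- `pot_symm` trades the column at `z` for the column at `m`, whose potential is at most one.
    have hGm : G m ≤ X.Q z / X.Q m * (X.esc m J)⁻¹ := by
      rw [hG, Pi.smul_apply, smul_eq_mul, inv_mul_eq_div, div_le_iff₀ hez, ← div_eq_mul_inv,
        div_div, div_mul_eq_mul_div, le_div_iff₀ (mul_pos (X.Q_pos m) hem)]
      have h1 : X.Q z * (X.harm {m} (insert m J) z * X.esc z J) ≤ X.Q z * X.esc z J :=
        mul_le_mul_of_nonneg_left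
          (mul_le_of_le_one_left hez.le (pot_le_one m J z)) (X.Q_nonneg z)
      linarith
    calc G m * X.harm {m} (M : Set Γ) z
        ≤ X.Q z / X.Q m * (X.esc m J)⁻¹ * X.harm {m} (M : Set Γ) z :=
          mul_le_mul_of_nonneg_right hGm (harm_singleton_nonneg hmM z)
      _ = _ := by ring
  · simp only [map_add, map_smul, map_sum, Pi.add_apply, Pi.smul_apply, smul_eq_mul,
      Finset.sum_apply]
    rw [Finset.sum_eq_zero fun m hm => by
      rw [lap_harm_singleton (Finset.mem_coe.2 (Finset.mem_filter.1 hm).1) hw, mul_zero], add_zero]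
    by_cases hwz : w = z
    · rw [hwz, hG, map_smul, Pi.smul_apply, smul_eq_mul, ← esc, ← esc, inv_mul_cancel₀ hez.ne',
        inv_mul_cancel₀ hezM.ne']
    · have hwJ : w ∉ J := fun h => hw (hJM h)
      rw [hG, map_smul, Pi.smul_apply, smul_eq_mul, lap_pot (by simp [hwz, hwJ]),
        lap_pot (by simpa [hwz] using hw), mul_zero, mul_zero]
  · have hr0 : ∀ m ∈ M.filter (· ∉ J), 0 ≤ G m * X.harm {m} (M : Set Γ) w := fun m hm =>
      mul_nonneg (hG0 m) (harm_singleton_nonneg (Finset.mem_coe.2 (Finset.mem_filter.1 hm).1) w)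
    simp only [Pi.add_apply, Pi.smul_apply, smul_eq_mul, Finset.sum_apply,
      harm_boundary hzM hw, mul_zero, zero_add]
    by_cases hwJ : w ∈ J
    · rw [hG, Pi.smul_apply, harm_boundary hzJ hwJ, smul_zero]
      exact Finset.sum_nonneg hr0
    · have := Finset.single_le_sum hr0 (Finset.mem_filter.2 ⟨hw, hwJ⟩)
      rwa [harm_singleton_self hw, mul_one] at this

variable (X) in
/-- The expected value under `Q` of the probability that `m` is the first visited point of `M`. -/
noncomputable def basin (M : Set Γ) (m : Γ) : ℝ := ∑ z, X.Q z * X.harm {m} M z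

-- Sum `esc_inv_le` over `z`; a point of `M` outside `J` is covered by its own summand. At fixed `m`
-- the sum over `z` produces `basin`.
open Classical in
theorem greenTrace_le (M : Finset Γ) {J : Set Γ} (hJ : J.Nonempty) (hJM : J ⊆ M) {b : ℝ}
    (hb : 0 < b) (hreach : ∀ z ∉ M, b ≤ X.esc z (M : Set Γ)) :
    X.greenTrace J ≤ Fintype.card Γ / b +
      ∑ m ∈ M with m ∉ J, (X.esc m J)⁻¹ * (X.basin M m / X.Q m) := by
  have hpt : ∀ z, (if z ∈ J then 0 else (X.esc z J)⁻¹) ≤ b⁻¹ + ∑ m ∈ M with m ∉ J,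
      X.harm {m} (M : Set Γ) z * (X.Q z / X.Q m) * (X.esc m J)⁻¹ := by
    intro z
    have hr0 : ∀ m ∈ M.filter (· ∉ J),
        0 ≤ X.harm {m} (M : Set Γ) z * (X.Q z / X.Q m) * (X.esc m J)⁻¹ := fun m hm => by
      obtain ⟨hmM, hmJ⟩ := Finset.mem_filter.1 hm
      exact mul_nonneg (mul_nonneg (harm_singleton_nonneg (Finset.mem_coe.2 hmM) z)
        (div_nonneg (X.Q_nonneg z) (X.Q_nonneg m))) (inv_nonneg.2 (esc_pos hJ hmJ).le)
    have hb0 := inv_pos.2 hb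
    split_ifs with hz
    · exact add_nonneg hb0.le (Finset.sum_nonneg hr0)
    · by_cases hzM : z ∈ M
      · have := Finset.single_le_sum hr0 (Finset.mem_filter.2 ⟨hzM, hz⟩)
        rw [harm_singleton_self (Finset.mem_coe.2 hzM), div_self (X.Q_pos z).ne', one_mul,
          one_mul] at this
        linarith
      · exact (esc_inv_le M hJ hJM hzM).trans
          (add_le_add_left (inv_anti₀ hb (hreach z hzM)) _)
  refine (Finset.sum_le_sum fun z _ => hpt z).trans_eq ?_
  rw [Finset.sum_add_distrib, Finset.sum_comm]
  congr 1
  · simp [div_eq_mul_inv]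
  · refine Finset.sum_congr rfl fun m _ => ?_
    rw [basin, Finset.sum_div, Finset.mul_sum]
    exact Finset.sum_congr rfl fun z _ => by ring

/-- If `x` is the first visited point of `M`, then `x` is visited before `I ⊆ M`. -/
theorem basin_div_le_potMass {I : Set Γ} (hIM : I ⊆ M) (hx : x ∈ M) :
    X.basin M x / X.Q x ≤ X.potMass I x := by
  have hsub : insert x I ⊆ M := Set.insert_subset hx hIM
  refine div_le_div_of_nonneg_right (Finset.sum_le_sum fun z _ =>
    mul_le_mul_of_nonneg_left ?_ (X.Q_nonneg z)) (X.Q_nonneg x)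
  refine X.comparison ⟨x, hx⟩ (fun w hw => ?_) (fun w hw => ?_) z
  · rw [lap_harm_singleton hx hw, lap_pot fun h => hw (hsub h)]
  · by_cases hwx : w = x
    · rw [hwx, harm_singleton_self hx, harm_self]
    · rw [harm_singleton_of_ne hx hw hwx]
      exact pot_nonneg x I w

theorem Q_le_mass {A : Set Γ} (hx : x ∈ A) : X.Q x ≤ X.mass A := by
  have h := Finset.single_le_sum (f := fun z => A.indicator X.Q z)
    (fun z _ => Set.indicator_nonneg (fun w _ => X.Q_nonneg w) z) (Finset.mem_univ x)
  rwa [Set.indicator_of_mem hx] at h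

theorem mass_le {A : Set Γ} {B : ℝ} (hB : 0 ≤ B) (h : ∀ z ∈ A, X.Q z ≤ B) :
    X.mass A ≤ Fintype.card Γ * B := by
  calc X.mass A ≤ ∑ _z : Γ, B := Finset.sum_le_sum fun z _ => by
        by_cases hz : z ∈ A
        · rw [Set.indicator_of_mem hz]; exact h z hz
        · rw [Set.indicator_of_notMem hz]; exact hB
    _ = _ := by simp

/-- A point of `M` from which the other points of `M` are rarely reached most likely
returns before it reaches them. -/
theorem harm_bounds_of_sum_esc_le [DecidableEq Γ] {M : Finset Γ} (hx : x ∈ M) {κ : ℝ}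
    (hs : ∑ y ∈ M.erase x, X.esc x {y} ≤ κ) :
    1 - κ ≤ X.P (X.harm {x} (M : Set Γ)) x ∧
      ∀ y ∈ M, y ≠ x → X.P (X.harm {y} (M : Set Γ)) x ≤ κ := by
  have hle : ∀ y ∈ M.erase x, X.P (X.harm {y} (M : Set Γ)) x ≤ X.esc x {y} := fun y hy =>
    P_harm_singleton_le_esc hx (Finset.mem_of_mem_erase hy) (Finset.ne_of_mem_erase hy).symm
  have h1 := sum_P_harm_singleton (X := X) M ⟨x, hx⟩ x
  rw [← Finset.add_sum_erase M _ hx] at h1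
  have h2 := Finset.sum_le_sum hle
  refine ⟨by linarith, fun y hy hyx => ?_⟩
  have hyE : y ∈ M.erase x := Finset.mem_erase.2 ⟨hyx, hy⟩
  have h3 := Finset.single_le_sum (f := fun y => X.esc x {y}) (fun y hy =>
    (esc_pos (Set.singleton_nonempty y) (Finset.ne_of_mem_erase hy).symm).le) hyE
  exact (hle y hyE).trans (h3.trans hs)

end Metastable

end RevChain

/-! ### Valleys and the mass attracted by metastable points. -/

namespace RevChain

variable {Γ : Type u} [Fintype Γ] [MeasurableSpace Γ] [DiscreteMeasurableSpace Γ]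
  {X : RevChain Γ} {M : Finset Γ} {a b ε ϵ : ℝ} {x y z m : Γ}

section Valley

theorem mem_valley_iff (hx : x ∈ M) : z ∈ X.valley M x ↔
    ∀ y ∈ M, X.P (X.harm {y} (M : Set Γ)) z ≤ X.P (X.harm {x} (M : Set Γ)) z := by
  have hval : ∀ y ∈ M, (X.law z).real {ω | hit {y} ω = hit (M : Set Γ) ω} =
      X.P (X.harm {y} (M : Set Γ)) z := fun y hy => law_hit_eq_hit hy z
  rw [valley, Set.mem_ofPred_eq]
  constructor
  · intro h y hy
    rw [← hval y hy, ← hval x hx]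
    exact h.2 ⟨y, hy, rfl⟩
  · intro h
    refine ⟨⟨x, hx, rfl⟩, ?_⟩
    rintro _ ⟨y, hy, rfl⟩
    change (X.law z).real _ ≤ _
    rw [hval y hy, hval x hx]
    exact h y hy

theorem exists_mem_valley (hM : M.Nonempty) (z : Γ) : ∃ x ∈ M, z ∈ X.valley M x := by
  obtain ⟨x, hx, hmax⟩ := M.exists_max_image (fun y => X.P (X.harm {y} (M : Set Γ)) z) hM
  exact ⟨x, hx, (mem_valley_iff hx).2 hmax⟩

theorem harm_le_of_mem_valley (hx : x ∈ M) (hy : y ∈ M) (hz : z ∉ M) (hzx : z ∈ X.valley M x) :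
    X.harm {y} (M : Set Γ) z ≤ X.harm {x} (M : Set Γ) z := by
  have h := (mem_valley_iff hx).1 hzx y hy
  have hP : ∀ y ∈ M, X.P (X.harm {y} (M : Set Γ)) z = X.harm {y} (M : Set Γ) z := fun y hy =>
    P_harm ⟨y, hy⟩ (Set.singleton_subset_iff.2 hy) hz
  rwa [hP y hy, hP x hx] at h

theorem R_pos (hx : x ∈ X.valley M x) : 0 < X.R M x :=
  div_pos (X.Q_pos x) ((X.Q_pos x).trans_le (Q_le_mass hx))

theorem R_le_one (hx : x ∈ X.valley M x) : X.R M x ≤ 1 :=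
  (div_le_one ((X.Q_pos x).trans_le (Q_le_mass hx))).2 (Q_le_mass hx)

theorem R_le_rMax (hx : x ∈ M) : X.R M x ≤ X.rMax M :=
  le_csSup (M.finite_toSet.image _).bddAbove ⟨x, hx, rfl⟩

theorem inv_R_le_c (hM : ∀ y ∈ M, y ∈ X.valley M y) (hx : x ∈ M) : (X.R M x)⁻¹ ≤ X.c M := by
  have hfin : (X.R M '' (M : Set Γ)).Finite := M.finite_toSet.image _
  have hpos : 0 < sInf (X.R M '' (M : Set Γ)) := by
    obtain ⟨y, hy, h⟩ := (Set.Nonempty.image (X.R M) ⟨x, hx⟩ :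
      (X.R M '' (M : Set Γ)).Nonempty).csInf_mem hfin
    rw [← h]
    exact R_pos (hM y hy)
  exact inv_anti₀ hpos (csInf_le hfin.bddBelow ⟨x, hx, rfl⟩)

theorem T_le_Tsup {I : Set Γ} (hx : x ∈ M) (hxI : x ∉ I) : X.T x I ≤ X.Tsup M I :=
  le_csSup ((M.finite_toSet.sdiff).image _).bddAbove ⟨x, ⟨hx, hxI⟩, rfl⟩

end Valley

theorem IsMetastable.reach_esc (h : X.IsMetastable M a b) (hz : z ∉ M) : b ≤ X.esc z (M : Set Γ) := by
  have := h.reach z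
  rwa [law_hit_le_hit (show z ∉ (M : Set Γ) from hz)] at this

theorem IsMetastable.esc_le (h : X.IsMetastable M a b) (hx : x ∈ M) (hy : y ∈ M) (hxy : x ≠ y) : X.esc x {y} ≤ a⁻¹ := by
  rw [← law_hit_lt_hit hxy]
  exact h.separated x hx y hy hxy

theorem IsMetastable.b_le_one (h : X.IsMetastable M a b) [Nonempty Γ] : b ≤ 1 := (h.reach (Classical.arbitrary Γ)).trans measureReal_le_one

theorem sum_esc_le_card (h : X.IsMetastable M a b) {S : Finset Γ} (hS : S ⊆ M)
    (hx : x ∈ M) (hxS : x ∉ S) : ∑ y ∈ S, X.esc x {y} ≤ M.card * a⁻¹ := by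
  calc ∑ y ∈ S, X.esc x {y} ≤ ∑ _y ∈ S, a⁻¹ := Finset.sum_le_sum fun y hy =>
        h.esc_le hx (hS hy) fun e => hxS (e ▸ hy)
    _ = S.card * a⁻¹ := by simp
    _ ≤ _ := mul_le_mul_of_nonneg_right (by exact_mod_cast Finset.card_le_card hS)
        (inv_nonneg.2 h.a_pos.le)

/-- The bound for a state outside `M` on the mass times the probability to enter `M` elsewhere
than in `x`. -/
theorem IsMetastable.Q_mul_one_sub_harm_le [DecidableEq Γ] (h : X.IsMetastable M a b) (hx : x ∈ M) (hz : z ∉ M)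
    (hzx : z ∈ X.valley M x) :
    X.Q z * ((1 - X.harm {x} (M : Set Γ) z) * b) ≤
      2 * ∑ y ∈ M.erase x, X.Q y * X.esc y {x} := by
  have hE := h.reach_esc hz
  have hsum : 1 - X.harm {x} (M : Set Γ) z = ∑ y ∈ M.erase x, X.harm {y} (M : Set Γ) z := by
    rw [← sum_harm_singleton M ⟨x, hx⟩ z, ← Finset.add_sum_erase M _ hx, add_sub_cancel_left]
  rw [hsum, Finset.sum_mul, Finset.mul_sum, Finset.mul_sum]
  refine Finset.sum_le_sum fun y hy => ?_
  obtain ⟨hyx, hyM⟩ := Finset.mem_erase.1 hy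
  refine le_trans ?_ (conductance_le_two_mul (X := X) (M := (M : Set Γ)) hz hyM hx hyx
    (harm_le_of_mem_valley hx hyM hz hzx))
  exact mul_le_mul_of_nonneg_left (mul_le_mul_of_nonneg_left hE
    (harm_singleton_nonneg (Finset.mem_coe.2 hyM) z)) (X.Q_nonneg z)

section Top

variable [DecidableEq Γ]

/-- The depths with respect to `{m}` are separated, hence so are the escape probabilities, and their
sum is at most two however many points `M` has. Dominance of the mass at `m` supplies the factor
`ϵ`. -/
theorem sum_Q_mul_esc_le (hg : X.IsGeneric M ϵ) (hϵ : ϵ ≤ 1 / 2) (hϵ0 : 0 ≤ ϵ) (hm : m ∈ M)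
    (htop : ∀ x ∈ M, x ≠ m → X.Q x ≤ ϵ * X.Q m) :
    ∑ y ∈ M.erase m, X.Q y * X.esc y {m} ≤ 2 * ϵ * X.Q m := by
  have hpos : ∀ y ∈ M.erase m, 0 < X.esc y {m} := fun y hy =>
    esc_pos (Set.singleton_nonempty m) (Finset.ne_of_mem_erase hy)
  have h2 : ∑ y ∈ M.erase m, X.esc y {m} ≤ 2 * 1 := by
    refine Finset.sum_le_two_mul_of_separated _ hϵ zero_le_one hpos
      (fun y _ => esc_le_one y {m}) fun i hi j hj hij => ?_
    obtain ⟨him, hiM⟩ := Finset.mem_erase.1 hi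
    obtain ⟨hjm, hjM⟩ := Finset.mem_erase.1 hj
    have hgap := hg.gap i hiM j hjM hij {m} (Finset.singleton_subset_iff.2 hm)
      (Finset.singleton_nonempty m) (by simpa using him) (by simpa using hjm)
    rw [Finset.coe_singleton, T_eq_esc_inv (show i ∉ ({m} : Set Γ) from him),
      T_eq_esc_inv (show j ∉ ({m} : Set Γ) from hjm)] at hgap
    have hi0 := hpos i hi
    have hj0 := hpos j hj
    rcases hgap with h | h
    · right
      rwa [← div_eq_mul_inv, inv_eq_one_div, div_le_div_iff₀ hi0 hj0, one_mul] at h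
    · left
      rwa [← div_eq_mul_inv, inv_eq_one_div, div_le_div_iff₀ hj0 hi0, one_mul] at h
  calc ∑ y ∈ M.erase m, X.Q y * X.esc y {m}
      ≤ ∑ y ∈ M.erase m, ϵ * X.Q m * X.esc y {m} := Finset.sum_le_sum fun y hy =>
        mul_le_mul_of_nonneg_right
          (htop y (Finset.mem_of_mem_erase hy) (Finset.ne_of_mem_erase hy)) (hpos y hy).le
    _ = ϵ * X.Q m * ∑ y ∈ M.erase m, X.esc y {m} := by rw [Finset.mul_sum]
    _ ≤ ϵ * X.Q m * (2 * 1) :=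
        mul_le_mul_of_nonneg_left h2 (mul_nonneg hϵ0 (X.Q_nonneg m))
    _ = _ := by ring

theorem mem_valley_self_of_sum_esc_le (hx : x ∈ M)
    (hs : ∑ y ∈ M.erase x, X.esc x {y} ≤ 1 / 2) : x ∈ X.valley M x := by
  obtain ⟨h1, h2⟩ := harm_bounds_of_sum_esc_le hx hs
  refine (mem_valley_iff hx).2 fun y hy => ?_
  by_cases hyx : y = x
  · rw [hyx]
  · linarith [h2 y hy hyx]

theorem notMem_valley_of_sum_esc_le (hx : x ∈ M) (hy : y ∈ M) (hyx : y ≠ x)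
    (hs : ∑ y ∈ M.erase x, X.esc x {y} ≤ 1 / 4) : x ∉ X.valley M y := by
  obtain ⟨h1, h2⟩ := harm_bounds_of_sum_esc_le hx hs
  intro h
  linarith [h2 y hy hyx, (mem_valley_iff hy).1 h x hx]

/-- The lower bound on `R` at the point of largest mass. -/
theorem le_R_top (h : X.IsMetastable M a b) (hg : X.IsGeneric M ϵ) (hϵ : ϵ ≤ 1 / 4) (hϵ0 : 0 ≤ ϵ)
    (hm : m ∈ M) (htop : ∀ x ∈ M, x ≠ m → X.Q x ≤ ϵ * X.Q m) :
    b ≤ 2 * Fintype.card Γ * X.R M m := by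
  have : Nonempty Γ := ⟨m⟩
  have hQ := X.Q_pos m
  have hb := h.b_pos
  have hb1 := h.b_le_one
  have hS := sum_Q_mul_esc_le hg (by linarith) hϵ0 hm htop
  -- No smallness of `M.card * a⁻¹` is available yet. Symmetry of conductances and
  -- `sum_Q_mul_esc_le` bound the total escape from `m` by `2 * ϵ ≤ 1 / 2` instead.
  have hself : m ∈ X.valley M m := by
    refine mem_valley_self_of_sum_esc_le hm ?_
    have h1 : X.Q m * ∑ y ∈ M.erase m, X.esc m {y} = ∑ y ∈ M.erase m, X.Q y * X.esc y {m} := by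
      rw [Finset.mul_sum]
      exact Finset.sum_congr rfl fun y hy => esc_symm (Finset.ne_of_mem_erase hy).symm
    refine le_of_mul_le_mul_left ?_ hQ
    rw [h1]
    nlinarith
  -- Off `M`, the parts of `X.Q z * b` that enter `M` at `m` and elsewhere are each at most `X.Q m`:
  -- the first by `conductance_le`, the second because `4 * ϵ ≤ 1`.
  have hmass : X.mass (X.valley M m) ≤ Fintype.card Γ * (2 * X.Q m / b) := by
    refine mass_le (by positivity) fun z hz => ?_
    rw [le_div_iff₀ hb]
    have hQz := X.Q_nonneg z
    by_cases hzM : z ∈ M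
    · have h1 : X.Q z ≤ X.Q m := by
        by_cases hzm : z = m
        · rw [hzm]
        · nlinarith [htop z hzM hzm]
      nlinarith
    · have h1 := h.Q_mul_one_sub_harm_le hm hzM hz
      have h2 := conductance_le (X := X) (M := (M : Set Γ)) hzM hm
      have h3 : X.Q z * (X.harm {m} (M : Set Γ) z * b) ≤
          X.Q z * (X.harm {m} (M : Set Γ) z * X.esc z (M : Set Γ)) :=
        mul_le_mul_of_nonneg_left (mul_le_mul_of_nonneg_left (h.reach_esc hzM)
          (harm_singleton_nonneg (Finset.mem_coe.2 hm) z)) hQz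
      nlinarith
  have hmpos := hQ.trans_le (Q_le_mass hself)
  rw [R, mul_div_assoc', le_div_iff₀ hmpos]
  calc b * X.mass (X.valley M m) ≤ b * (Fintype.card Γ * (2 * X.Q m / b)) :=
        mul_le_mul_of_nonneg_left hmass hb.le
    _ = _ := by field_simp

end Top

section Basin

variable [DecidableEq Γ]

/-- Upper bound on the mass attracted by a metastable point. -/
theorem basin_le (h : X.IsMetastable M a b) (hε : a⁻¹ ≤ ε * b) (hm : m ∈ M) (hε0 : 0 ≤ ε) :
    X.basin (M : Set Γ) m ≤
      X.Q m + X.mass (X.valley M m) + Fintype.card Γ * (2 * ε * X.Q m) := by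
  classical
  have hb := h.b_pos
  have hc : 0 ≤ 2 * ε * X.Q m := mul_nonneg (by linarith) (X.Q_nonneg m)
  have hpt : ∀ z, X.Q z * X.harm {m} (M : Set Γ) z ≤
      (if z = m then X.Q m else 0) + (X.valley M m).indicator X.Q z + 2 * ε * X.Q m := by
    intro z
    have hQz := X.Q_nonneg z
    have hind : 0 ≤ (X.valley M m).indicator X.Q z :=
      Set.indicator_nonneg (fun w _ => X.Q_nonneg w) z
    by_cases hzM : z ∈ M
    · by_cases hzm : z = m
      · rw [if_pos hzm, hzm, harm_singleton_self (Finset.mem_coe.2 hm), mul_one]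
        rw [hzm] at hind
        linarith
      · rw [harm_singleton_of_ne (Finset.mem_coe.2 hm) hzM hzm, mul_zero, if_neg hzm]
        linarith
    · have hzm : z ≠ m := fun e => hzM (e ▸ hm)
      rw [if_neg hzm, zero_add]
      by_cases hzv : z ∈ X.valley M m
      · rw [Set.indicator_of_mem hzv]
        have := mul_le_of_le_one_right hQz (harm_le_one (X := X) (A := {m}) (S := (M : Set Γ))
          ⟨m, hm⟩ (Set.singleton_subset_iff.2 hm) z)
        linarith
      · rw [Set.indicator_of_notMem hzv, zero_add]
        -- A state outside the valley of `m` prefers another point `y`, so its conductance to `m` is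
        -- at most twice that between `m` and `y`.
        obtain ⟨y, hy, hzy⟩ := exists_mem_valley (X := X) ⟨m, hm⟩ z
        have hmy : m ≠ y := fun e => hzv (e ▸ hzy)
        have h1 := conductance_le_two_mul (X := X) (M := (M : Set Γ)) hzM hm hy hmy
          (harm_le_of_mem_valley hy hm hzM hzy)
        have h2 : X.Q z * (X.harm {m} (M : Set Γ) z * b) ≤
            X.Q z * (X.harm {m} (M : Set Γ) z * X.esc z (M : Set Γ)) :=
          mul_le_mul_of_nonneg_left (mul_le_mul_of_nonneg_left (h.reach_esc hzM)
            (harm_singleton_nonneg (Finset.mem_coe.2 hm) z)) hQz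
        have h3 : X.Q m * X.esc m {y} ≤ X.Q m * (ε * b) :=
          mul_le_mul_of_nonneg_left ((h.esc_le hm hy hmy).trans hε) (X.Q_nonneg m)
        refine le_of_mul_le_mul_right ?_ hb
        nlinarith
  calc X.basin (M : Set Γ) m ≤ ∑ z, ((if z = m then X.Q m else 0) +
        (X.valley M m).indicator X.Q z + 2 * ε * X.Q m) := Finset.sum_le_sum fun z _ => hpt z
    _ = _ := by
      rw [Finset.sum_add_distrib, Finset.sum_add_distrib, Finset.sum_ite_eq',
        if_pos (Finset.mem_univ m)]
      simp [mass]

/-- Lower bound on the mass attracted by a metastable point. -/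
theorem le_basin (h : X.IsMetastable M a b) (hε : a⁻¹ ≤ ε * b) (hx : x ∈ M) (hε0 : 0 ≤ ε)
    (hval : ∀ z ∈ M, z ∈ X.valley M x → z = x) :
    X.mass (X.valley M x) ≤
      X.basin (M : Set Γ) x + Fintype.card Γ * (2 * M.card * ε * X.Q x) := by
  classical
  have hb := h.b_pos
  have hc : 0 ≤ 2 * M.card * ε * X.Q x :=
    mul_nonneg (mul_nonneg (by positivity) hε0) (X.Q_nonneg x)
  have hpt : ∀ z, (X.valley M x).indicator X.Q z ≤
      X.Q z * X.harm {x} (M : Set Γ) z + 2 * M.card * ε * X.Q x := by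
    intro z
    have hQz := X.Q_nonneg z
    have h0 : 0 ≤ X.Q z * X.harm {x} (M : Set Γ) z :=
      mul_nonneg hQz (harm_singleton_nonneg (Finset.mem_coe.2 hx) z)
    by_cases hzv : z ∈ X.valley M x
    · rw [Set.indicator_of_mem hzv]
      by_cases hzM : z ∈ M
      · rw [hval z hzM hzv, harm_singleton_self (Finset.mem_coe.2 hx)]
        linarith
      · have h1 := h.Q_mul_one_sub_harm_le hx hzM hzv
        -- Symmetry moves the weight to `x`; otherwise the masses of the other points of `M` would
        -- enter.
        have h2 : ∑ y ∈ M.erase x, X.Q y * X.esc y {x} ≤ X.Q x * (M.card * (ε * b)) := by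
          rw [Finset.sum_congr rfl fun y hy => esc_symm (Finset.ne_of_mem_erase hy),
            ← Finset.mul_sum]
          refine mul_le_mul_of_nonneg_left ?_ (X.Q_nonneg x)
          exact (sum_esc_le_card h (Finset.erase_subset x M) hx (Finset.notMem_erase x M)).trans
            (mul_le_mul_of_nonneg_left hε (Nat.cast_nonneg _))
        refine le_of_mul_le_mul_right ?_ hb
        linarith
    · rw [Set.indicator_of_notMem hzv]
      linarith
  calc X.mass (X.valley M x) ≤
        ∑ z, (X.Q z * X.harm {x} (M : Set Γ) z + 2 * M.card * ε * X.Q x) :=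
        Finset.sum_le_sum fun z _ => hpt z
    _ = _ := by
      rw [Finset.sum_add_distrib]
      simp [basin]

end Basin

end RevChain

/-! ### Assembling the exponential law. -/

namespace RevChain

variable {Γ : Type u} [Fintype Γ] [MeasurableSpace Γ] [DiscreteMeasurableSpace Γ]
  {X : RevChain Γ} {M I : Finset Γ} {a b ε ϵ : ℝ} {x : Γ}

/-- In the metastable regime every metastable point lies in its own valley and in no other one,
and the mass of its valley is comparable to the mass it attracts. -/
theorem valley_bounds (h : X.IsMetastable M a b) (hε : a⁻¹ ≤ ε * b) (hg : X.IsGeneric M ϵ)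
    (hϵ : ϵ ≤ 1 / 4) (hη : X.rMax M * ε * Fintype.card Γ * M.card ≤ 1 / 16)
    (hM : M.Nontrivial) :
    (∀ x ∈ M, x ∈ X.valley M x) ∧
      (∀ x ∈ M, Fintype.card Γ * ε * M.card * X.R M x ≤ 1 / 16) ∧
      ∀ x ∈ M, (X.R M x)⁻¹ / 2 ≤ X.basin (M : Set Γ) x / X.Q x ∧
        X.basin (M : Set Γ) x / X.Q x ≤ 3 * X.c M := by
  classical
  have ha := inv_pos.2 h.a_pos
  have hb := h.b_pos
  have hε0 : 0 < ε := pos_of_mul_pos_left (ha.trans_le hε) hb.le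
  obtain ⟨m, hm, htop⟩ := hg.top
  obtain ⟨w, hw, hwm⟩ := hM.exists_ne m
  have hϵ0 : 0 ≤ ϵ := by
    have h1 := (X.Q_pos w).trans_le (htop w hw hwm)
    exact (pos_of_mul_pos_left h1 (X.Q_nonneg m)).le
  have hRm := le_R_top h hg hϵ hϵ0 hm htop
  have hR : ∀ x ∈ M, Fintype.card Γ * ε * M.card * X.R M x ≤ 1 / 16 := fun x hx => by
    have h1 : Fintype.card Γ * ε * M.card * X.R M x ≤ Fintype.card Γ * ε * M.card * X.rMax M :=
      mul_le_mul_of_nonneg_left (R_le_rMax hx) (by positivity)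
    linarith
  -- The assumption controls `rMax * ε * |Γ| * |M|`. The lower bound on `R` at the heaviest point
  -- absorbs `b`: `|M| / a ≤ |M| ε b ≤ 2 |M| ε |Γ| R ≤ 1 / 8`.
  have hcard : M.card * a⁻¹ ≤ 1 / 8 := by
    have h1 : M.card * a⁻¹ ≤ M.card * (ε * (2 * Fintype.card Γ * X.R M m)) :=
      mul_le_mul_of_nonneg_left (hε.trans (mul_le_mul_of_nonneg_left hRm hε0.le))
        (Nat.cast_nonneg _)
    linarith [hR m hm]
  have hesc : ∀ x ∈ M, ∑ y ∈ M.erase x, X.esc x {y} ≤ 1 / 8 := fun x hx =>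
    (sum_esc_le_card h (Finset.erase_subset x M) hx (Finset.notMem_erase x M)).trans hcard
  have hself : ∀ x ∈ M, x ∈ X.valley M x := fun x hx =>
    mem_valley_self_of_sum_esc_le hx ((hesc x hx).trans (by norm_num))
  refine ⟨hself, hR, fun x hx => ?_⟩
  have hval : ∀ z ∈ M, z ∈ X.valley M x → z = x := fun z hz hzx => by
    by_contra hne
    exact notMem_valley_of_sum_esc_le hz hx (Ne.symm hne) ((hesc z hz).trans (by norm_num)) hzx
  have hQ := X.Q_pos x
  have hmass : X.Q x ≤ X.mass (X.valley M x) := Q_le_mass (hself x hx)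
  have hmass0 := hQ.trans_le hmass
  have hRx := R_pos (hself x hx)
  have hQR : X.Q x = X.R M x * X.mass (X.valley M x) := (div_mul_cancel₀ _ hmass0.ne').symm
  have hinv : (X.R M x)⁻¹ = X.mass (X.valley M x) / X.Q x := by rw [R, inv_div]
  have hsmall : Fintype.card Γ * (2 * M.card * ε * X.Q x) ≤ X.mass (X.valley M x) / 8 := by
    have h1 := mul_le_mul_of_nonneg_right (hR x hx) hmass0.le
    have h2 : Fintype.card Γ * ε * M.card * X.R M x * X.mass (X.valley M x) =
        Fintype.card Γ * ε * M.card * X.Q x := by rw [hQR]; ring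
    linarith
  have hlow := le_basin h hε hx hε0.le hval
  have hupp := basin_le h hε hx hε0.le
  have hcard1 : (1 : ℝ) ≤ M.card := by exact_mod_cast Finset.card_pos.2 ⟨x, hx⟩
  have hsmall' : Fintype.card Γ * (2 * ε * X.Q x) ≤ X.mass (X.valley M x) / 8 := by
    refine le_trans ?_ hsmall
    have h1 : 0 ≤ Fintype.card Γ * (2 * ε * X.Q x) := by positivity
    have h2 := mul_le_mul_of_nonneg_left hcard1 h1
    linarith
  constructor
  · rw [hinv, div_div, mul_comm, ← div_div]
    exact div_le_div_of_nonneg_right (by linarith) hQ.le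
  · refine le_trans ?_ (mul_le_mul_of_nonneg_left (inv_R_le_c hself hx) (by norm_num))
    rw [hinv, mul_div_assoc']
    exact div_le_div_of_nonneg_right (by linarith) hQ.le

/-- The trace of the Green function is bounded by the second depth. -/
theorem greenTrace_add_one_le (h : X.IsMetastable M a b) (hε : a⁻¹ ≤ ε * b)
    (hg : X.IsGeneric M ϵ) (hϵ : ϵ ≤ 1 / 4)
    (hη : X.rMax M * ε * Fintype.card Γ * M.card ≤ 1 / 16) (hIM : I ⊆ M) (hI : I.Nonempty)
    (hx : x ∈ M) (hxI : x ∉ I) :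
    X.greenTrace (insert x (I : Set Γ)) + 1 ≤ 8 * (X.c M * X.secondDepth M b I x) := by
  classical
  have : Nonempty Γ := ⟨x⟩
  have hM : M.Nontrivial := by
    obtain ⟨i, hi⟩ := hI
    exact ⟨i, hIM hi, x, hx, fun e => hxI (e ▸ hi)⟩
  obtain ⟨hself, hR, hbasin⟩ := valley_bounds h hε hg hϵ hη hM
  have ha := inv_pos.2 h.a_pos
  have hb := h.b_pos
  have hb1 := h.b_le_one
  have hε0 : 0 < ε := pos_of_mul_pos_left (ha.trans_le hε) hb.le
  have hRx := R_pos (hself x hx)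
  have hc1 : 1 ≤ X.c M :=
    ((one_le_inv₀ hRx).2 (R_le_one (hself x hx))).trans (inv_R_le_c hself hx)
  have hcΓ : (1 : ℝ) ≤ Fintype.card Γ := by exact_mod_cast Fintype.card_pos
  set J : Finset Γ := insert x I with hJ
  have hJs : (insert x (I : Set Γ)) = (J : Set Γ) := (Finset.coe_insert x I).symm
  have hJM : J ⊆ M := Finset.insert_subset hx hIM
  have hJne : (J : Set Γ).Nonempty := ⟨x, Finset.mem_coe.2 (Finset.mem_insert_self x I)⟩
  have hG : X.greenTrace (J : Set Γ) ≤ Fintype.card Γ / b +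
      ∑ m ∈ M with m ∉ (J : Set Γ), (X.esc m (J : Set Γ))⁻¹ *
        (X.basin (M : Set Γ) m / X.Q m) := by
    convert! greenTrace_le (X := X) M hJne (Finset.coe_subset.2 hJM) hb
      fun z hz => h.reach_esc hz
  rw [secondDepth, hJs]
  split_ifs with hne
  · set T₂ := X.Tsup M (J : Set Γ) with hT₂
    have hT : ∀ m ∈ M.filter (· ∉ (J : Set Γ)), (X.esc m (J : Set Γ))⁻¹ ≤ T₂ ∧
        0 < (X.esc m (J : Set Γ))⁻¹ := fun m hm => by
      obtain ⟨hmM, hmJ⟩ := Finset.mem_filter.1 hm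
      refine ⟨?_, inv_pos.2 (esc_pos hJne hmJ)⟩
      rw [← T_eq_esc_inv hmJ]
      exact T_le_Tsup hmM hmJ
    obtain ⟨m, hmM, hmJ⟩ := hne
    have hmf : m ∈ M.filter (· ∉ (J : Set Γ)) := Finset.mem_filter.2 ⟨hmM, hmJ⟩
    have hem := esc_pos (X := X) hJne hmJ
    have hT₂1 : 1 ≤ T₂ :=
      ((one_le_inv₀ hem).2 (esc_le_one m _)).trans (hT m hmf).1
    have hT₂0 : 0 ≤ T₂ := by linarith
    have hsum : ∑ m ∈ M with m ∉ (J : Set Γ), (X.esc m (J : Set Γ))⁻¹ ≤ 2 * T₂ := by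
      refine Finset.sum_le_two_mul_of_separated _ (hϵ.trans (by norm_num)) hT₂0
        (fun m hm => (hT m hm).2) (fun m hm => (hT m hm).1) fun i hi j hj hij => ?_
      obtain ⟨hiM, hiJ⟩ := Finset.mem_filter.1 hi
      obtain ⟨hjM, hjJ⟩ := Finset.mem_filter.1 hj
      rw [← T_eq_esc_inv hiJ, ← T_eq_esc_inv hjJ]
      exact hg.gap i hiM j hjM hij J hJM (Finset.coe_nonempty.1 hJne) hiJ hjJ
    have hsum2 : ∑ m ∈ M with m ∉ (J : Set Γ), (X.esc m (J : Set Γ))⁻¹ *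
        (X.basin (M : Set Γ) m / X.Q m) ≤ 6 * (X.c M * T₂) := by
      calc _ ≤ ∑ m ∈ M with m ∉ (J : Set Γ), (X.esc m (J : Set Γ))⁻¹ * (3 * X.c M) :=
            Finset.sum_le_sum fun m hm => mul_le_mul_of_nonneg_left
              (hbasin m (Finset.mem_filter.1 hm).1).2 (hT m hm).2.le
        _ = (∑ m ∈ M with m ∉ (J : Set Γ), (X.esc m (J : Set Γ))⁻¹) * (3 * X.c M) := by
            rw [Finset.sum_mul]
        _ ≤ (2 * T₂) * (3 * X.c M) := mul_le_mul_of_nonneg_right hsum (by linarith)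
        _ = _ := by ring
    -- Escape from `m` to `J` has probability at most `|M| ε b`, so `T₂` is at least the inverse of
    -- this, and `|Γ| ε |M| ≤ 1 / R ≤ c`.
    have hdepth : (Fintype.card Γ : ℝ) / b ≤ X.c M * T₂ := by
      have h1 : X.esc m (J : Set Γ) ≤ M.card * (ε * b) :=
        (esc_le_sum J (Finset.mem_coe.not.1 hmJ)).trans
          ((sum_esc_le_card h hJM hmM (Finset.mem_coe.not.1 hmJ)).trans
            (mul_le_mul_of_nonneg_left hε (Nat.cast_nonneg _)))
      have h2 : 1 ≤ T₂ * (M.card * (ε * b)) := by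
        calc (1 : ℝ) = (X.esc m (J : Set Γ))⁻¹ * X.esc m (J : Set Γ) :=
              (inv_mul_cancel₀ hem.ne').symm
          _ ≤ T₂ * X.esc m (J : Set Γ) := mul_le_mul_of_nonneg_right (hT m hmf).1 hem.le
          _ ≤ _ := mul_le_mul_of_nonneg_left h1 hT₂0
      have h3 : Fintype.card Γ * ε * M.card ≤ X.c M := by
        refine le_trans ?_ (inv_R_le_c hself hx)
        rw [← one_div, le_div_iff₀ hRx]
        linarith [hR x hx]
      rw [div_le_iff₀ hb]
      calc (Fintype.card Γ : ℝ) = Fintype.card Γ * 1 := (mul_one _).symm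
        _ ≤ Fintype.card Γ * (T₂ * (M.card * (ε * b))) :=
            mul_le_mul_of_nonneg_left h2 (Nat.cast_nonneg _)
        _ = (Fintype.card Γ * ε * M.card) * (T₂ * b) := by ring
        _ ≤ X.c M * (T₂ * b) := mul_le_mul_of_nonneg_right h3 (by positivity)
        _ = _ := by ring
    -- The constant eight is `1 + 6 + 1`: the term `|Γ| / b`, the sum over metastable points, and
    -- the added one.
    have h1 : 1 ≤ X.c M * T₂ := by nlinarith
    linarith
  -- With no metastable point left, only the local time scale `|Γ| / b` remains, which is the value
  -- of `secondDepth` in this case.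
  · have hempty : M.filter (· ∉ (J : Set Γ)) = ∅ :=
      Finset.filter_eq_empty_iff.2 fun m hm hmJ => hne ⟨m, hm, hmJ⟩
    rw [hempty, Finset.sum_empty, add_zero] at hG
    have h1 : 1 ≤ (Fintype.card Γ : ℝ) / b := by
      rw [le_div_iff₀ hb]; linarith
    have h2 : (Fintype.card Γ : ℝ) / b ≤ X.c M * ((Fintype.card Γ : ℝ) / b) :=
      le_mul_of_one_le_left (by linarith) hc1
    linarith

/-- The exponential law for a single chain in the metastable regime. -/
theorem exponential_law (h : X.IsMetastable M a b) (hε : a⁻¹ ≤ ε * b)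
    (hg : X.IsGeneric M ϵ) (hϵ : ϵ ≤ 1 / 4)
    (hη : X.rMax M * ε * Fintype.card Γ * M.card ≤ 1 / 16) (hIM : I ⊆ M) (hI : I.Nonempty)
    (hx : x ∈ M) (hxI : x ∉ I) (hT : X.T x (I : Set Γ) = X.Tsup M (I : Set Γ)) :
    X.meanHit x (I : Set Γ) ≠ ∞ ∧
      ∀ t : ℝ, (∃ n : ℕ, t * (X.meanHit x (I : Set Γ)).toReal = n) →
        ∃ A B : ℝ,
          |A - 1| ≤ 128 * (X.R M x * X.c M * X.secondDepth M b I x / X.Tsup M (I : Set Γ)) ∧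
          |B - 1| ≤ 128 * (X.R M x * X.c M * X.secondDepth M b I x / X.Tsup M (I : Set Γ)) ∧
          (X.law x).real {ω | ENNReal.ofReal t * X.meanHit x (I : Set Γ) <
            (hit (I : Set Γ) ω : ℝ≥0∞)} = A * Real.exp (-t * B) := by
  have hM : M.Nontrivial := by
    obtain ⟨i, hi⟩ := hI
    exact ⟨i, hIM hi, x, hx, fun e => hxI (e ▸ hi)⟩
  have hIs : (I : Set Γ).Nonempty := Finset.coe_nonempty.2 hI
  have hxIs : x ∉ (I : Set Γ) := hxI
  obtain ⟨hself, -, hbasin⟩ := valley_bounds h hε hg hϵ hη hM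
  have hD := greenTrace_add_one_le h hε hg hϵ hη hIM hI hx hxI
  have hD0 := greenTrace_nonneg (X := X) (Set.insert_nonempty x (I : Set Γ))
  obtain ⟨u, hu, hlap⟩ := exists_mean (X := X) hIs
  have hmean := meanHit_eq hIs hu hlap hxIs
  set δ := X.R M x * X.c M * X.secondDepth M b I x / X.Tsup M (I : Set Γ) with hδ
  have hRx := R_pos (hself x hx)
  have hesc := esc_pos (X := X) hIs hxIs
  have hE1 : (X.R M x)⁻¹ / 2 ≤ X.esc x (I : Set Γ) * u x := by
    rw [esc_mul_mean hxIs hu hlap]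
    exact (hbasin x hx).1.trans
      (basin_div_le_potMass (Finset.coe_subset.2 hIM) (Finset.mem_coe.2 hx))
  have hu0 : 0 < u x := by
    have h1 : 0 < X.esc x (I : Set Γ) * u x := lt_of_lt_of_le (by positivity) hE1
    exact (mul_pos_iff_of_pos_left hesc).1 h1
  -- The constant is `8 * 2`, from `D + 1 ≤ 8 c T₂` and `u x ≥ T₁ / (2 R)`.
  have hδE : (X.greenTrace (insert x (I : Set Γ)) + 1) / u x ≤ 16 * δ := by
    have hTe : X.Tsup M (I : Set Γ) = (X.esc x (I : Set Γ))⁻¹ := by rw [← hT, T_eq_esc_inv hxIs]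
    rw [div_le_iff₀ hu0, hδ, hTe, div_inv_eq_mul]
    have h1 : 1 ≤ 2 * X.R M x * (X.esc x (I : Set Γ) * u x) := by
      have h2 := mul_le_mul_of_nonneg_left hE1 (show 0 ≤ 2 * X.R M x by positivity)
      have h3 : 2 * X.R M x * ((X.R M x)⁻¹ / 2) = 1 := by field_simp
      linarith
    have h4 : 0 ≤ 8 * (X.c M * X.secondDepth M b I x) := by linarith
    have h5 := mul_le_mul_of_nonneg_left h1 h4
    linarith
  have hδ0 : 0 < δ := by
    have : 0 < (X.greenTrace (insert x (I : Set Γ)) + 1) / u x := by positivity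
    linarith
  refine ⟨by rw [hmean]; exact ENNReal.ofReal_ne_top, fun t ht => ?_⟩
  obtain ⟨n, hn⟩ := ht
  rw [hmean, ENNReal.toReal_ofReal hu0.le] at hn
  have htn : t = n / u x := by rw [eq_div_iff hu0.ne', hn]
  have ht0 : 0 ≤ t := by rw [htn]; positivity
  have hset : {ω : ℕ → Γ | ENNReal.ofReal t * X.meanHit x (I : Set Γ) <
      (hit (I : Set Γ) ω : ℝ≥0∞)} = {ω | (n : ℕ∞) < hit (I : Set Γ) ω} := by
    ext ω
    rw [Set.mem_ofPred_eq, Set.mem_ofPred_eq, hmean, ← ENNReal.ofReal_mul ht0, hn,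
      ENNReal.ofReal_natCast, ← ENat.toENNReal_coe, ENat.toENNReal_lt]
  rw [hset, law_lt_hit n hxIs]
  -- In the main case `128 = 2 * 4 * 16`, and `16 * δ ≤ 1 / 8` is the smallness needed for
  -- `abs_log_surv_add_le`. Otherwise the allowed error exceeds one, so `B = 0` and the probability
  -- itself as `A` will do.
  rcases le_or_gt (128 * δ) 1 with hsmall | hbig
  · have hE8 : 8 * (X.greenTrace (insert x (I : Set Γ)) + 1) ≤ u x := by
      rw [div_le_iff₀ hu0] at hδE
      nlinarith
    obtain ⟨hpos, hlog⟩ := abs_log_surv_add_le hIs hxIs hu hlap hE8 n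
    rw [← htn] at hlog
    obtain ⟨A, B, hA, hB, hAB⟩ := exists_exponential_form hpos ht0
      (show 64 * δ ≤ 1 by linarith) (hlog.trans
        (mul_le_mul_of_nonneg_right (by linarith) (by linarith)))
    exact ⟨A, B, by linarith, by linarith, hAB⟩
  · refine ⟨X.surv (I : Set Γ) n x, 0, ?_, ?_, by simp⟩
    · have h1 := surv_nonneg (X := X) (I := (I : Set Γ)) n x
      have h2 := surv_le_one (X := X) (I := (I : Set Γ)) n x
      rw [abs_le]
      constructor <;> linarith
    · rw [zero_sub, abs_neg, abs_one]
      exact hbig.le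

end RevChain

theorem corollary6p2 :
    ∃ C : ℝ, 0 < C ∧
      ∀ (Γ : ℕ → Type u) [∀ N, Fintype (Γ N)] [∀ N, MeasurableSpace (Γ N)]
        [∀ N, DiscreteMeasurableSpace (Γ N)]
        (X : ∀ N, RevChain (Γ N)) (M : ∀ N, Finset (Γ N)) (a b ε ϵ : ℕ → ℝ),
        (∀ N, (X N).IsMetastable (M N) (a N) (b N)) →
        (∀ N, (a N)⁻¹ ≤ ε N * b N) →
        Tendsto ε atTop (𝓝 0) →
        (∀ N, (X N).IsGeneric (M N) (ϵ N)) →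
        Tendsto ϵ atTop (𝓝 0) →
        Tendsto (fun N => (X N).rMax (M N) * ε N * (Fintype.card (Γ N) : ℝ) * ((M N).card : ℝ))
          atTop (𝓝 0) →
        ∀ᶠ N in atTop, ∀ I ⊆ M N, I.Nonempty → ∀ m₁ ∈ M N, m₁ ∉ I →
          (X N).T m₁ (I : Set (Γ N)) = (X N).Tsup (M N) (I : Set (Γ N)) →
          (X N).meanHit m₁ (I : Set (Γ N)) ≠ ∞ ∧
          ∀ t : ℝ, (∃ n : ℕ, t * ((X N).meanHit m₁ (I : Set (Γ N))).toReal = n) →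
            ∃ A B : ℝ,
              |A - 1| ≤ C * ((X N).R (M N) m₁ * (X N).c (M N) *
                (X N).secondDepth (M N) (b N) I m₁ / (X N).Tsup (M N) (I : Set (Γ N))) ∧
              |B - 1| ≤ C * ((X N).R (M N) m₁ * (X N).c (M N) *
                (X N).secondDepth (M N) (b N) I m₁ / (X N).Tsup (M N) (I : Set (Γ N))) ∧
              ((X N).law m₁).real
                {ω | ENNReal.ofReal t * (X N).meanHit m₁ (I : Set (Γ N)) <
                  (hit (I : Set (Γ N)) ω : ℝ≥0∞)} = A * Real.exp (-t * B) := by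
  refine ⟨128, by norm_num, ?_⟩
  intro Γ _ _ _ X M a b ε ϵ hmet hε _ hgen hϵ hη
  filter_upwards [hϵ.eventually_le_const (show (0 : ℝ) < 1 / 4 by norm_num),
    hη.eventually_le_const (show (0 : ℝ) < 1 / 16 by norm_num)] with N h1 h2
  intro I hIM hI m₁ hm₁ hm₁I hT
  exact RevChain.exponential_law (hmet N) (hε N) (hgen N) h1 h2 hIM hI hm₁ hm₁I hT
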